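/- Let $\mathcal G=(\mathcal V,\mathcal E)$ be a digraph without self-loops on $n\ge 2$ agents, let $\mathcal N_i=\{j:(j,i)\in\mathcal E\}$ be the set of in-neighbours of $i$, let $f\ge 0$ be an integer, and let $\mathcal F\subset\mathcal V$ be a set of faulty agents with $|\mathcal F|\le f$. Assume that $\mathcal G$ is $(3f+1)$-robust: of any two nonempty disjoint sets of nodes, at least one contains a node $i$ with at least $3f+1$ in-neighbours outside that set. Let $c>0$ and $\tfrac12<q<1$. The DP-MSR algorithm runs as follows. Each non-faulty agent $i$ starts at a deterministic value $\theta_i(0)=\theta_{0,i}\in\mathbb R$. At each time $k\ge 0$ it sends $x_i(k)=\theta_i(k)+\eta_i(k)$ to all its out-neighbours, where $\eta_i(k)$ has the zero-mean Laplace distribution $\mathrm{Lap}(cq^k)$ with density $\frac{1}{2cq^k}e^{-|x|/(cq^k)}$. It removes the $f$ largest and the $f$ smallest of the values received from its in-neighbours (breaking ties arbitrarily), and sets $$\theta_i(k+1)=a_i\theta_i(k)+\sum_{j\in\mathcal N_i^*(k)}a_i\,x_j(k),\qquad a_i=\frac{1}{|\mathcal N_i|-2f+1},$$ where $\mathcal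 N_i^*(k)$ is the set of in-neighbours whose values were not removed and, for a faulty $j$, $x_j(k)$ stands for the message that $i$ receives from $j$. A faulty agent $j$ sends to each out-neighbour $i$ a possibly different message $\widehat x_j^i(k)=\widehat\theta_j^i(k)+\widehat\eta_j^i(k)$, where $\widehat\theta_j^i$ is an arbitrary deterministic signal (which may depend on the initial condition) and $\widehat\eta_j^i(k)$ is a zero-mean noise of variance at most $2c^2q^{2k}$. The noises of different agents and of different times are mutually independent; the noises that a faulty agent sends to its various out-neighbours at one time may be dependent on each other. Then, for every $p\in(0,1)$, this dynamics is $\left(p,\;c\sqrt{\frac{n-f}{2p(1-q^2)}}\right)$-accurate. That is, for every initial condition and all deterministic attack signals there is a random variable $\theta_\infty$ with finite expected value such that the states $\theta_i(k)$ of all non-faulty agents $i$ have finite second moments and converge to $\theta_\infty$ in mean square as $k\to\infty$, and $$\mathbb P\left\{|\theta_\infty-\mathbb E[\theta_\infty]|\le c\sqrt{\frac{n-f}{2p(1-q^2)}}\right\}\ge 1-p .$$ -/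

import Mathlib

open MeasureTheory ProbabilityTheory Filter Topology

noncomputable section

namespace DPMSR

/-! ### Directed graphs and robustness -/

section Graph

variable {V : Type*} [Fintype V]

open Classical in
/-- In-neighbours of `i`: the agents `j` with an edge `(j, i)`. -/
def inNbrs (G : Digraph V) (i : V) : Finset V :=
  Finset.univ.filter fun j => G.Adj j i

open Classical in
/-- `S` is `r`-reachable: some node of `S` has at least `r` in-neighbours outside `S`. -/
def IsReachable (G : Digraph V) (r : ℕ) (S : Finset V) : Prop :=
  ∃ i ∈ S, r ≤ (inNbrs G i \ S).card

/-- `r`-robustness: of any two nonempty disjoint sets of nodes, at least one is `r`-reachable. -/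
def IsRobust (G : Digraph V) (r : ℕ) : Prop :=
  ∀ S T : Finset V, S.Nonempty → T.Nonempty → Disjoint S T →
    IsReachable G r S ∨ IsReachable G r T

end Graph

/-! ### The Laplace distribution -/

/-- The zero-mean Laplace distribution `Lap(b)`, with density `exp (-|x| / b) / (2 b)`. -/
def laplace (b : ℝ) : Measure ℝ :=
  volume.withDensity fun x => ENNReal.ofReal (1 / (2 * b) * Real.exp (-|x| / b))

/-! ### The algorithm -/

section Algorithm

variable {V Ω : Type*}

open Classical in
/-- `S` is what may remain of the set of senders `N`, with received values `r`, after removing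
`f` smallest and `f` largest values (ties being broken in any way). -/
def IsRetained (f : ℕ) (r : V → ℝ) (N S : Finset V) : Prop :=
  ∃ L U : Finset V, L ⊆ N ∧ U ⊆ N ∧ Disjoint L U ∧ L.card = f ∧ U.card = f ∧
    (∀ l ∈ L, ∀ j ∈ N \ L, r l ≤ r j) ∧ (∀ u ∈ U, ∀ j ∈ N \ U, r j ≤ r u) ∧
    S = N \ (L ∪ U)

open Classical in
/-- The noise that agent `j` adds at time `k` to its message for each recipient.  A non-faulty
agent adds the same `η k j` for all recipients; a faulty one may add a different
`ηhat k j i` for each recipient `i`. -/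
def noise (F : Finset V) (η : ℕ → V → Ω → ℝ) (ηhat : ℕ → V → V → Ω → ℝ)
    (k : ℕ) (j : V) (ω : Ω) (i : V) : ℝ :=
  if j ∈ F then ηhat k j i ω else η k j ω

open Classical in
/-- The message from `j` to `i` at time `k`: internal state plus noise for a non-faulty `j`,
attack signal `θhat k j i` plus noise for a faulty `j`. -/
def message (F : Finset V) (θhat : ℕ → V → V → ℝ) (η : ℕ → V → Ω → ℝ)
    (ηhat : ℕ → V → V → Ω → ℝ) (θ : ℕ → V → Ω → ℝ) (k : ℕ) (j i : V) (ω : Ω) : ℝ :=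
  (if j ∈ F then θhat k j i else θ k j ω) + noise F η ηhat k j ω i

/-- `θ` is an execution of DP-MSR started at `θ₀`: every non-faulty agent starts at its initial
value, and at each step replaces its state by the average of its state and the messages that it
has not removed.  Faulty agents are constrained only through the messages that they send. -/
structure IsExecution [Fintype V] (G : Digraph V) (F : Finset V) (f : ℕ)
    (θhat : ℕ → V → V → ℝ) (η : ℕ → V → Ω → ℝ) (ηhat : ℕ → V → V → Ω → ℝ)
    (θ₀ : V → ℝ) (θ : ℕ → V → Ω → ℝ) : Prop where
  init : ∀ i ∉ F, ∀ ω, θ 0 i ω = θ₀ i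
  step : ∀ k, ∀ i ∉ F, ∀ ω, ∃ S : Finset V,
    IsRetained f (fun j => message F θhat η ηhat θ k j i ω) (inNbrs G i) S ∧
    θ (k + 1) i ω =
      1 / (((inNbrs G i).card : ℝ) - 2 * f + 1) * θ k i ω +
        ∑ j ∈ S, 1 / (((inNbrs G i).card : ℝ) - 2 * f + 1) *
          message F θhat η ηhat θ k j i ω

/-- The network dynamics: the executions of DP-MSR started at `θ₀`, for all deterministic attack
signals of the faulty agents (which may therefore depend on `θ₀`). -/
def dynamics [Fintype V] (G : Digraph V) (F : Finset V) (f : ℕ)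
    (η : ℕ → V → Ω → ℝ) (ηhat : ℕ → V → V → Ω → ℝ)
    (θ₀ : V → ℝ) (θ : ℕ → V → Ω → ℝ) : Prop :=
  ∃ θhat : ℕ → V → V → ℝ, IsExecution G F f θhat η ηhat θ₀ θ

end Algorithm

/-! ### Accuracy -/

/-- Mean square convergence of a sequence of random variables `X k` to `Y`: every `X k` has a
finite second moment, and the second moment of `X k - Y` tends to `0`. -/
def TendstoInMeanSquare {Ω : Type*} [MeasurableSpace Ω] (P : Measure Ω)
    (X : ℕ → Ω → ℝ) (Y : Ω → ℝ) : Prop :=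
  (∀ k, MemLp (X k) 2 P) ∧
    Tendsto (fun k => ∫⁻ ω, ENNReal.ofReal (|X k ω - Y ω| ^ 2) ∂P) atTop (𝓝 0)

/-- `(p, r)`-accuracy of a network dynamics `D` with set `F` of faulty agents, where `D θ₀ θ`
says that the process `θ` is a possible evolution from the initial condition `θ₀`: the states of
the non-faulty agents converge to a common random variable, of finite expected value, which lies
within `r` of that expected value with probability at least `1 - p`. -/
def IsAccurate {V Ω : Type*} [MeasurableSpace Ω] (P : Measure Ω) (F : Finset V)
    (D : (V → ℝ) → (ℕ → V → Ω → ℝ) → Prop) (p r : ℝ) : Prop :=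
  ∀ (θ₀ : V → ℝ) (θ : ℕ → V → Ω → ℝ), D θ₀ θ →
    ∃ θinf : Ω → ℝ, Measurable θinf ∧ Integrable θinf P ∧
      (∀ i ∉ F, TendstoInMeanSquare P (fun k => θ k i) θinf) ∧
      1 - p ≤ P.real {ω | |θinf ω - ∫ ω', θinf ω' ∂P| ≤ r}

end DPMSR

end

/-! Agreement and accuracy have separate reasons.

Agreement is pathwise. At most `f` senders are faulty, so every retained value lies between the
extreme non-faulty states, up to noise. If the non-faulty states lie in `[m, M]`, consider those
above and those below the midpoint. While both sets are nonempty, robustness gives an agent of one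
of them with `3 f + 1` in-neighbours outside its set. Trimming removes `2 f` values and at most `f`
senders are faulty, so a non-faulty value from outside is averaged in and pulls the agent away from
its extreme. Relative to thresholds that relax geometrically, no agent enters the sets and one
leaves at each such step. After `n` steps one set is empty, and the spread has shrunk by a fixed
factor up to noise (`IsTrimmedPath.sub_le_contraction`). The noise is geometrically small in `L²`,
so the spread vanishes and the states are Cauchy in `L²`.

Accuracy is a bounded differences estimate. Two trimmed sums differ by at most the termwise
differences over one set as large as a retained set (`IsRetained.exists_sum_sub_le`). Hence the
update is nonexpansive in the sup norm: a noise enters with weight at most `1 / (f + 2)` and its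
effect never grows. An Efron-Stein inequality (`exists_lintegral_sub_sq_le_sum`) adds up the squared
effects, a faulty agent counting once per out-neighbour. With `n ≥ 3 f + 2` this bounds the variance
by `c ^ 2 (n - f) / (2 (1 - q ^ 2))`; the bound passes to the limit, and Chebyshev's inequality
concludes. -/

noncomputable section

namespace DPMSR

/-! ### Trimmed sums and their stability -/

section Trimming

open scoped Classical

variable {V : Type*}

theorem sum_le_sum_of_exchange {A B : Finset V} {r : V → ℝ} (hcard : A.card = B.card)
    (h : ∀ a ∈ A \ B, ∀ b ∈ B \ A, r a ≤ r b) : ∑ j ∈ A, r j ≤ ∑ j ∈ B, r j := by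
  have hc : (A \ B).card = (B \ A).card := Finset.card_sdiff_comm hcard
  have h1 : ∑ j ∈ A \ B, r j ≤ ∑ j ∈ B \ A, r j := by
    rcases (A \ B).eq_empty_or_nonempty with he | hne
    · rw [he, Finset.card_empty] at hc
      rw [he, Finset.card_eq_zero.mp hc.symm]
    · obtain ⟨a, ha, hmax⟩ := Finset.exists_max_image _ r hne
      calc ∑ j ∈ A \ B, r j ≤ (A \ B).card • r a := Finset.sum_le_card_nsmul _ _ _ hmax
        _ = (B \ A).card • r a := by rw [hc]
        _ ≤ _ := Finset.card_nsmul_le_sum _ _ _ (h a ha)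
  rw [← Finset.sum_inter_add_sum_sdiff A B, ← Finset.sum_inter_add_sum_sdiff B A,
    Finset.inter_comm B A]
  linarith

theorem IsRetained.card_add {f : ℕ} {r : V → ℝ} {N S : Finset V} (h : IsRetained f r N S) :
    S.card + 2 * f = N.card := by
  obtain ⟨L, U, hL, hU, hd, hLc, hUc, -, -, rfl⟩ := h
  have h1 := Finset.card_sdiff_add_card_eq_card (Finset.union_subset hL hU)
  rw [Finset.card_union_of_disjoint hd] at h1
  convert h1 using 2
  omega

theorem IsRetained.subset {f : ℕ} {r : V → ℝ} {N S : Finset V} (h : IsRetained f r N S) :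
    S ⊆ N := by
  obtain ⟨L, U, -, -, -, -, -, -, -, rfl⟩ := h
  intro x hx
  simp at hx
  exact hx.1

theorem IsRetained.neg {f : ℕ} {r : V → ℝ} {N S : Finset V} (h : IsRetained f r N S) :
    IsRetained f (fun j => -r j) N S := by
  obtain ⟨L, U, hL, hU, hd, hLc, hUc, h1, h2, rfl⟩ := h
  refine ⟨U, L, hU, hL, hd.symm, hUc, hLc, fun l hl j hj => neg_le_neg (h2 l hl j hj),
    fun l hl j hj => neg_le_neg (h1 l hl j hj), ?_⟩
  rw [Finset.union_comm]

/-- Discard from `S` its members in `U'` and put back equally many members of `U \ U'`. The sum of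
`r` does not drop, because `U` carries the largest values of `r`. The resulting `B` avoids `U'`, so
its members outside `S'` lie in `L'`, and its sum of `r'` is at most that of `S'`. -/
theorem IsRetained.exists_sum_sub_le {f : ℕ} {r r' : V → ℝ} {N S S' : Finset V}
    (h : IsRetained f r N S) (h' : IsRetained f r' N S') :
    ∃ B ⊆ N, B.card + 2 * f = N.card ∧
      ∑ j ∈ S, r j - ∑ j ∈ S', r' j ≤ ∑ j ∈ B, (r j - r' j) := by
  have hc := h.card_add
  have hc' := h'.card_add
  obtain ⟨L, U, hL, hU, hd, hLc, hUc, h1, h2, hS⟩ := h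
  obtain ⟨L', U', hL', hU', hd', hLc', hUc', h1', h2', hS'⟩ := h'
  have memS : ∀ x, x ∈ S ↔ x ∈ N ∧ x ∉ L ∧ x ∉ U := by
    intro x; rw [hS]; simp
  have memS' : ∀ x, x ∈ S' ↔ x ∈ N ∧ x ∉ L' ∧ x ∉ U' := by
    intro x; rw [hS']; simp
  -- Enough replacements exist: `S ∩ U'` lies in `U' \ U`, which is as large as `U \ U'`.
  have hle : (S ∩ U').card ≤ (U \ U').card := by
    rw [Finset.card_sdiff_comm (hUc.trans hUc'.symm)]
    apply Finset.card_le_card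
    intro x hx
    rw [Finset.mem_inter, memS] at hx
    exact Finset.mem_sdiff.mpr ⟨hx.2, hx.1.2.2⟩
  obtain ⟨T, hT, hTc⟩ := Finset.exists_subset_card_eq hle
  have memT : ∀ x ∈ T, x ∈ U ∧ x ∉ U' := fun x hx => Finset.mem_sdiff.mp (hT hx)
  have hdisj : Disjoint (S \ U') T := by
    rw [Finset.disjoint_left]
    intro x hx hxT
    exact ((memS x).mp (Finset.mem_sdiff.mp hx).1).2.2 (memT x hxT).1
  have hBc : ((S \ U') ∪ T).card = S.card := by
    rw [Finset.card_union_of_disjoint hdisj, hTc, Finset.card_sdiff_add_card_inter]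
  refine ⟨(S \ U') ∪ T, ?_, by rw [hBc]; exact hc, ?_⟩
  · intro x hx
    rcases Finset.mem_union.mp hx with hx | hx
    · exact ((memS x).mp (Finset.mem_sdiff.mp hx).1).1
    · exact hU (memT x hx).1
  · have e1 : ∑ j ∈ S, r j ≤ ∑ j ∈ (S \ U') ∪ T, r j := by
      apply sum_le_sum_of_exchange hBc.symm
      intro s hs b hb
      rw [Finset.mem_sdiff] at hs hb
      have hbU : b ∈ U := by
        rcases Finset.mem_union.mp hb.1 with hb' | hb'
        · exact absurd (Finset.mem_sdiff.mp hb').1 hb.2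
        · exact (memT b hb').1
      exact h2 b hbU s (Finset.mem_sdiff.mpr ⟨((memS s).mp hs.1).1, ((memS s).mp hs.1).2.2⟩)
    have e2 : ∑ j ∈ (S \ U') ∪ T, r' j ≤ ∑ j ∈ S', r' j := by
      apply sum_le_sum_of_exchange (by omega)
      intro b hb s hs
      rw [Finset.mem_sdiff] at hs hb
      have hbN : b ∈ N ∧ b ∉ U' := by
        rcases Finset.mem_union.mp hb.1 with hb' | hb'
        · exact ⟨((memS b).mp (Finset.mem_sdiff.mp hb').1).1, (Finset.mem_sdiff.mp hb').2⟩
        · exact ⟨hU (memT b hb').1, (memT b hb').2⟩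
      have hbL : b ∈ L' := by
        by_contra hbL
        exact hb.2 ((memS' b).mpr ⟨hbN.1, hbL, hbN.2⟩)
      exact h1' b hbL s (Finset.mem_sdiff.mpr ⟨((memS' s).mp hs.1).1, ((memS' s).mp hs.1).2.1⟩)
    rw [Finset.sum_sub_distrib]
    linarith

theorem exists_smallest_subset (r : V → ℝ) (N : Finset V) (m : ℕ) (hm : m ≤ N.card) :
    ∃ L ⊆ N, L.card = m ∧ ∀ l ∈ L, ∀ j ∈ N \ L, r l ≤ r j := by
  induction m with
  | zero => exact ⟨∅, by simp, by simp, by simp⟩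
  | succ m ih =>
    obtain ⟨L, hL, hLc, hmin⟩ := ih (by omega)
    have hne : (N \ L).Nonempty := by
      rw [← Finset.card_pos, Finset.card_sdiff_of_subset hL]
      omega
    obtain ⟨a, ha, hamin⟩ := Finset.exists_min_image _ r hne
    have ha' := Finset.mem_sdiff.mp ha
    refine ⟨insert a L, Finset.insert_subset ha'.1 hL, ?_, ?_⟩
    · rw [Finset.card_insert_of_notMem ha'.2, hLc]
    · intro l hl j hj
      rw [Finset.mem_sdiff, Finset.mem_insert, not_or] at hj
      have hj' : j ∈ N \ L := Finset.mem_sdiff.mpr ⟨hj.1, hj.2.2⟩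
      rcases Finset.mem_insert.mp hl with rfl | hl
      · exact hamin j hj'
      · exact hmin l hl j hj'

theorem exists_isRetained (f : ℕ) (r : V → ℝ) (N : Finset V) (hN : 2 * f ≤ N.card) :
    ∃ S, IsRetained f r N S := by
  obtain ⟨L, hL, hLc, hmin⟩ := exists_smallest_subset r N f (by omega)
  obtain ⟨U, hU, hUc, hmax⟩ := exists_smallest_subset (fun j => -r j) (N \ L) f (by
    rw [Finset.card_sdiff_of_subset hL]; omega)
  have hUN : ∀ u ∈ U, u ∈ N ∧ u ∉ L := fun u hu => Finset.mem_sdiff.mp (hU hu)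
  refine ⟨_, L, U, hL, fun u hu => (hUN u hu).1, ?_, hLc, hUc, hmin, ?_, rfl⟩
  · rw [Finset.disjoint_right]
    exact fun u hu => (hUN u hu).2
  · intro u hu j hj
    rw [Finset.mem_sdiff] at hj
    by_cases hjL : j ∈ L
    · exact hmin j hjL u (hU hu)
    · exact neg_le_neg_iff.mp (hmax u hu j (by simp [hj, hjL]))

/-- The sum of the values that remain after trimming; it does not depend on how ties are broken. -/
def trimmedSum (f : ℕ) (N : Finset V) (r : V → ℝ) : ℝ :=
  if h : ∃ S, IsRetained f r N S then ∑ j ∈ h.choose, r j else 0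

/-- Comparing `r` with itself makes the bound of `exists_sum_sub_le` zero, in both directions. -/
theorem IsRetained.sum_eq {f : ℕ} {r : V → ℝ} {N S : Finset V} (h : IsRetained f r N S) :
    ∑ j ∈ S, r j = trimmedSum f N r := by
  have hex : ∃ S, IsRetained f r N S := ⟨S, h⟩
  rw [trimmedSum, dif_pos hex]
  obtain ⟨B, -, -, h1⟩ := h.exists_sum_sub_le hex.choose_spec
  obtain ⟨B', -, -, h2⟩ := hex.choose_spec.exists_sum_sub_le h
  simp only [sub_self, Finset.sum_const_zero] at h1 h2
  linarith

theorem exists_trimmedSum_sub_le {f : ℕ} {N : Finset V} (hN : 2 * f ≤ N.card) (r r' : V → ℝ) :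
    ∃ B ⊆ N, B.card + 2 * f = N.card ∧
      trimmedSum f N r - trimmedSum f N r' ≤ ∑ j ∈ B, (r j - r' j) := by
  obtain ⟨S, hS⟩ := exists_isRetained f r N hN
  obtain ⟨S', hS'⟩ := exists_isRetained f r' N hN
  rw [← hS.sum_eq, ← hS'.sum_eq]
  exact hS.exists_sum_sub_le hS'

theorem abs_trimmedSum_sub_le {f : ℕ} {N : Finset V} (hN : 2 * f ≤ N.card) (r r' : V → ℝ) :
    ∃ B ⊆ N, B.card + 2 * f = N.card ∧
      |trimmedSum f N r - trimmedSum f N r'| ≤ ∑ j ∈ B, |r j - r' j| := by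
  rcases abs_choice (trimmedSum f N r - trimmedSum f N r') with h | h
  · obtain ⟨B, hB, hBc, hle⟩ := exists_trimmedSum_sub_le hN r r'
    refine ⟨B, hB, hBc, ?_⟩
    rw [h]
    exact hle.trans (Finset.sum_le_sum fun j _ => le_abs_self _)
  · obtain ⟨B, hB, hBc, hle⟩ := exists_trimmedSum_sub_le hN r' r
    refine ⟨B, hB, hBc, ?_⟩
    rw [h, neg_sub]
    refine hle.trans (Finset.sum_le_sum fun j _ => ?_)
    rw [abs_sub_comm]
    exact le_abs_self _

theorem continuous_trimmedSum [Fintype V] {f : ℕ} {N : Finset V} (hN : 2 * f ≤ N.card) :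
    Continuous (trimmedSum f N : (V → ℝ) → ℝ) := by
  refine LipschitzWith.continuous (K := Fintype.card V) (LipschitzWith.of_dist_le_mul ?_)
  intro r r'
  obtain ⟨B, -, -, hle⟩ := abs_trimmedSum_sub_le hN r r'
  rw [Real.dist_eq]
  refine hle.trans ?_
  calc ∑ j ∈ B, |r j - r' j| ≤ ∑ j ∈ B, dist r r' :=
        Finset.sum_le_sum fun j _ => by rw [← Real.dist_eq]; exact dist_le_pi_dist r r' j
    _ = B.card * dist r r' := by simp
    _ ≤ _ := by
      gcongr
      simpa using Finset.card_le_univ B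

/-- If a retained value exceeded `hi`, so would the `f` removed largest ones, and all `f + 1`
senders would be faulty. -/
theorem IsRetained.le_of_forall_le {f : ℕ} {r : V → ℝ} {N S F : Finset V}
    (h : IsRetained f r N S) (hF : F.card ≤ f) {hi : ℝ} (hhi : ∀ j ∈ N, j ∉ F → r j ≤ hi) :
    ∀ j ∈ S, r j ≤ hi := by
  obtain ⟨L, U, hL, hU, hd, hLc, hUc, h1, h2, rfl⟩ := h
  intro j hj
  by_contra! hlt
  simp only [Finset.mem_sdiff, Finset.mem_union, not_or] at hj
  have key : insert j U ⊆ F := by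
    intro x hx
    by_contra hxF
    rcases Finset.mem_insert.mp hx with rfl | hx
    · exact absurd (hhi x hj.1 hxF) (not_le.mpr hlt)
    · have := h2 x hx j (Finset.mem_sdiff.mpr ⟨hj.1, hj.2.2⟩)
      linarith [hhi x (hU hx) hxF]
  have := Finset.card_le_card key
  rw [Finset.card_insert_of_notMem hj.2.2] at this
  omega

end Trimming

/-! ### Pathwise contraction of the spread under robustness -/

section Contraction

open scoped Classical

variable {V : Type*} [Fintype V]

/-- The weight `a_i` with which agent `i` averages its state and the retained messages. -/
def weight (G : Digraph V) (f : ℕ) (i : V) : ℝ :=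
  1 / (((inNbrs G i).card : ℝ) - 2 * f + 1)

/-- A sample path `x` of trimmed averaging with received values `r k i j` (from `j` to `i`), where
the messages of the agents outside `F` differ from their states by at most `W k`. -/
structure IsTrimmedPath (G : Digraph V) (F : Finset V) (f : ℕ) (x : ℕ → V → ℝ)
    (r : ℕ → V → V → ℝ) (W : ℕ → ℝ) : Prop where
  step : ∀ k, ∀ i ∉ F, ∃ S, IsRetained f (r k i) (inNbrs G i) S ∧
    x (k + 1) i = weight G f i * x k i + ∑ j ∈ S, weight G f i * r k i j
  msg : ∀ k i j, j ∉ F → |r k i j - x k j| ≤ W k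

variable {G : Digraph V} {F : Finset V} {f : ℕ} {x : ℕ → V → ℝ} {r : ℕ → V → V → ℝ} {W : ℕ → ℝ}

theorem weight_pos {i : V} (h : 2 * f ≤ (inNbrs G i).card) : 0 < weight G f i := by
  have : ((2 * f : ℕ) : ℝ) ≤ (inNbrs G i).card := by exact_mod_cast h
  push_cast at this
  exact div_pos one_pos (by linarith)

/-- For `m` the size of a retained set, this makes the update a convex combination. -/
theorem weight_mul_card {i : V} {m : ℕ} (h : m + 2 * f = (inNbrs G i).card) :
    weight G f i * (1 + m) = 1 := by
  have : ((m + 2 * f : ℕ) : ℝ) = (inNbrs G i).card := by exact_mod_cast h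
  push_cast at this
  have hm : (0 : ℝ) ≤ m := by positivity
  rw [weight, ← this, show (m : ℝ) + 2 * f - 2 * f + 1 = 1 + m by ring]
  field_simp

theorem le_weight {i : V} (h : 2 * f ≤ (inNbrs G i).card) :
    1 / ((Fintype.card V : ℝ) + 1) ≤ weight G f i := by
  have h1 : ((2 * f : ℕ) : ℝ) ≤ (inNbrs G i).card := by exact_mod_cast h
  have h2 : ((inNbrs G i).card : ℝ) ≤ Fintype.card V := by
    exact_mod_cast Finset.card_le_univ _
  push_cast at h1
  have hf : (0 : ℝ) ≤ f := by positivity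
  exact one_div_le_one_div_of_le (by linarith) (by linarith)

namespace IsTrimmedPath

theorem neg (h : IsTrimmedPath G F f x r W) :
    IsTrimmedPath G F f (fun k i => -x k i) (fun k i j => -r k i j) W where
  step k i hi := by
    obtain ⟨S, hS, hx⟩ := h.step k i hi
    refine ⟨S, hS.neg, ?_⟩
    rw [hx]
    simp only [mul_neg, Finset.sum_neg_distrib]
    ring
  msg k i j hj := by
    have := h.msg k i j hj
    rwa [neg_sub_neg, abs_sub_comm]

theorem W_nonneg (h : IsTrimmedPath G F f x r W) {i : V} (hi : i ∉ F) (k : ℕ) : 0 ≤ W k :=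
  (abs_nonneg _).trans (h.msg k i i hi)

theorem retained_le (h : IsTrimmedPath G F f x r W) (hF : F.card ≤ f) {k : ℕ} {M : ℝ}
    (hM : ∀ j ∉ F, x k j ≤ M) {i : V} {S : Finset V}
    (hS : IsRetained f (r k i) (inNbrs G i) S) : ∀ j ∈ S, r k i j ≤ M + W k := by
  refine hS.le_of_forall_le hF fun j _ hj => ?_
  have := (abs_le.mp (h.msg k i j hj)).2
  linarith [hM j hj]

theorem step_le_of_self (h : IsTrimmedPath G F f x r W) (hF : F.card ≤ f) {k : ℕ} {M : ℝ}
    (hM : ∀ j ∉ F, x k j ≤ M) {i : V} (hi : i ∉ F) :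
    x (k + 1) i ≤ M + W k - 1 / ((Fintype.card V : ℝ) + 1) * (M - x k i) := by
  obtain ⟨S, hS, hx⟩ := h.step k i hi
  have hW := h.W_nonneg hi k
  have hcard := hS.card_add
  have hw := weight_mul_card hcard
  have hle := le_weight (G := G) (f := f) (i := i) (by omega)
  have hpos := weight_pos (G := G) (f := f) (i := i) (by omega)
  have hsum : ∑ j ∈ S, r k i j ≤ S.card * (M + W k) := by
    simpa only [nsmul_eq_mul] using Finset.sum_le_card_nsmul _ _ _ (h.retained_le hF hM hS)
  rw [hx, ← Finset.mul_sum]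
  have h1 := mul_le_mul_of_nonneg_left hsum hpos.le
  have h2 := mul_le_mul_of_nonneg_right hle (sub_nonneg.mpr (hM i hi))
  have h3 : weight G f i * (S.card * (M + W k)) =
      (M + W k) - weight G f i * (M + W k) := by
    linear_combination (M + W k) * hw
  have h4 := mul_nonneg hpos.le hW
  linarith

theorem step_le (h : IsTrimmedPath G F f x r W) (hF : F.card ≤ f) {k : ℕ} {M : ℝ}
    (hM : ∀ j ∉ F, x k j ≤ M) {i : V} (hi : i ∉ F) : x (k + 1) i ≤ M + W k := by
  have h1 := h.step_le_of_self hF hM hi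
  have h2 : 0 ≤ 1 / ((Fintype.card V : ℝ) + 1) * (M - x k i) :=
    mul_nonneg (by positivity) (sub_nonneg.mpr (hM i hi))
  linarith

/-- Of the `3 f + 1` in-neighbours outside `A`, at most `2 f` are trimmed and at most `f` are
faulty. So some retained message is non-faulty and from outside `A`, and its deficit `ε` enters with
weight at least `1 / (n + 1)`. -/
theorem step_le_of_nbrs (h : IsTrimmedPath G F f x r W) (hF : F.card ≤ f) {k : ℕ} {M ε : ℝ}
    (hε : 0 ≤ ε) (hM : ∀ j ∉ F, x k j ≤ M) {i : V} (hi : i ∉ F) {A : Finset V}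
    (hA : ∀ j ∉ F, j ∉ A → x k j ≤ M - ε) (hcardA : 3 * f + 1 ≤ (inNbrs G i \ A).card) :
    x (k + 1) i ≤ M + W k - 1 / ((Fintype.card V : ℝ) + 1) * ε := by
  obtain ⟨S, hS, hx⟩ := h.step k i hi
  have hW := h.W_nonneg hi k
  have hcard := hS.card_add
  have hw := weight_mul_card hcard
  have hle := le_weight (G := G) (f := f) (i := i) (by omega)
  have hpos := weight_pos (G := G) (f := f) (i := i) (by omega)
  obtain ⟨j, hjS, hjA, hjF⟩ : ∃ j ∈ S, j ∉ A ∧ j ∉ F := by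
    by_contra! hcon
    have hsub : inNbrs G i \ A ⊆ (inNbrs G i \ S) ∪ F := by
      intro j hj
      rw [Finset.mem_sdiff] at hj
      rw [Finset.mem_union, Finset.mem_sdiff]
      by_cases hjS : j ∈ S
      · exact Or.inr (hcon j hjS hj.2)
      · exact Or.inl ⟨hj.1, hjS⟩
    have h1 := (Finset.card_le_card hsub).trans (Finset.card_union_le _ _)
    rw [Finset.card_sdiff_of_subset hS.subset] at h1
    omega
  have hr := h.retained_le hF hM hS
  have hj : r k i j ≤ M + W k - ε := by
    have := (abs_le.mp (h.msg k i j hjF)).2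
    linarith [hA j hjF hjA]
  have hsum : ∑ j ∈ S, r k i j ≤ S.card * (M + W k) - ε := by
    have h1 : ∑ l ∈ S.erase j, r k i l ≤ (S.erase j).card * (M + W k) := by
      simpa only [nsmul_eq_mul] using Finset.sum_le_card_nsmul (S.erase j) _ _
        fun l hl => hr l (Finset.mem_of_mem_erase hl)
    have h2 : ((S.erase j).card : ℝ) + 1 = S.card := by
      exact_mod_cast Finset.card_erase_add_one hjS
    rw [← Finset.sum_erase_add _ _ hjS, ← h2]
    linarith
  rw [hx, ← Finset.mul_sum]
  have h1 := mul_le_mul_of_nonneg_left hsum hpos.le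
  have h2 := mul_le_mul_of_nonneg_right hle hε
  have h3 : weight G f i * (S.card * (M + W k) - ε) =
      (M + W k) - weight G f i * (M + W k) - weight G f i * ε := by
    linear_combination (M + W k) * hw
  have h4 := mul_nonneg hpos.le hW
  have h5 := mul_le_mul_of_nonneg_left (hM i hi) hpos.le
  linarith

theorem le_add_sum (h : IsTrimmedPath G F f x r W) (hF : F.card ≤ f) {k : ℕ} {M : ℝ}
    (hM : ∀ j ∉ F, x k j ≤ M) (l : ℕ) :
    ∀ j ∉ F, x (k + l) j ≤ M + ∑ s ∈ Finset.range l, W (k + s) := by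
  induction l with
  | zero => simpa using hM
  | succ l ih =>
    intro j hj
    have := h.step_le hF ih hj
    rw [Finset.sum_range_succ, ← add_assoc, ← add_assoc]
    exact this

theorem abs_sub_le (h : IsTrimmedPath G F f x r W) (hF : F.card ≤ f) {k : ℕ} {m M : ℝ}
    (hm : ∀ j ∉ F, m ≤ x k j) (hM : ∀ j ∉ F, x k j ≤ M) (l : ℕ) {i : V} (hi : i ∉ F) :
    |x (k + l) i - x k i| ≤ M - m + ∑ s ∈ Finset.range l, W (k + s) := by
  have h1 := h.le_add_sum hF hM l i hi
  have h2 := h.neg.le_add_sum hF (M := -m) (fun j hj => neg_le_neg (hm j hj)) l i hi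
  rw [abs_le]
  constructor <;> linarith [hm i hi, hM i hi]

/-- The agents outside `F` whose state exceeds `t`. -/
def above (F : Finset V) (y : V → ℝ) (t : ℝ) : Finset V :=
  Finset.univ.filter fun i => i ∉ F ∧ t < y i

theorem mem_above {y : V → ℝ} {t : ℝ} {i : V} : i ∈ above F y t ↔ i ∉ F ∧ t < y i := by
  simp [above]

/-- The threshold, which recedes by the factor `1 / (n + 1)` per step, below the largest possible
state. -/
def level (V : Type*) [Fintype V] (W : ℕ → ℝ) (k : ℕ) (M ε : ℝ) (l : ℕ) : ℝ :=
  M + ∑ s ∈ Finset.range l, W (k + s) - (1 / ((Fintype.card V : ℝ) + 1)) ^ l * ε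

theorem level_succ (k : ℕ) (M ε : ℝ) (l : ℕ) : level V W k M ε (l + 1) =
    M + ∑ s ∈ Finset.range l, W (k + s) + W (k + l) -
      1 / ((Fintype.card V : ℝ) + 1) * ((1 / ((Fintype.card V : ℝ) + 1)) ^ l * ε) := by
  rw [level, Finset.sum_range_succ, pow_succ]
  ring

/-- An agent at or below the threshold keeps at least the fraction `1 / (n + 1)` of its deficit,
which is the rate at which the threshold recedes. -/
theorem above_succ_subset (h : IsTrimmedPath G F f x r W) (hF : F.card ≤ f) {k : ℕ} {M ε : ℝ}
    (hM : ∀ j ∉ F, x k j ≤ M) (l : ℕ) :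
    above F (x (k + (l + 1))) (level V W k M ε (l + 1)) ⊆
      above F (x (k + l)) (level V W k M ε l) := by
  intro i hi
  rw [mem_above, level_succ] at hi
  rw [mem_above]
  refine ⟨hi.1, ?_⟩
  by_contra! hle
  have h1 := h.step_le_of_self hF (h.le_add_sum hF hM l) hi.1
  have h2 : (1 / ((Fintype.card V : ℝ) + 1)) ^ l * ε ≤
      M + ∑ s ∈ Finset.range l, W (k + s) - x (k + l) i := by
    rw [level] at hle
    linarith
  have h3 := mul_le_mul_of_nonneg_left h2
    (show 0 ≤ 1 / ((Fintype.card V : ℝ) + 1) by positivity)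
  have h4 := hi.2
  rw [← add_assoc] at h4
  linarith

theorem card_above_succ_lt (h : IsTrimmedPath G F f x r W) (hF : F.card ≤ f) {k : ℕ} {M ε : ℝ}
    (hε : 0 ≤ ε) (hM : ∀ j ∉ F, x k j ≤ M) (l : ℕ)
    (hreach : IsReachable G (3 * f + 1) (above F (x (k + l)) (level V W k M ε l))) :
    (above F (x (k + (l + 1))) (level V W k M ε (l + 1))).card <
      (above F (x (k + l)) (level V W k M ε l)).card := by
  obtain ⟨i, hi, hcard⟩ := hreach
  have hiF := (mem_above.mp hi).1
  apply Finset.card_lt_card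
  refine (Finset.ssubset_iff_of_subset (h.above_succ_subset hF hM l)).mpr ⟨i, hi, ?_⟩
  rw [mem_above, level_succ, not_and, not_lt, ← add_assoc]
  intro _
  refine h.step_le_of_nbrs hF (by positivity) (h.le_add_sum hF hM l) hiF
    (A := above F (x (k + l)) (level V W k M ε l)) (fun j hj hjA => ?_) ?_
  · rw [mem_above, not_and, not_lt] at hjA
    exact hjA hj
  · convert hcard

/-- While both sets are nonempty, robustness makes one of them reachable; it loses an agent and the
other does not grow. An empty set stays empty. Low agents are treated as high agents of the negated
path. -/
theorem card_above_add_le (h : IsTrimmedPath G F f x r W) (hF : F.card ≤ f)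
    (hrob : IsRobust G (3 * f + 1)) {k : ℕ} {m M : ℝ} (hmM : m ≤ M)
    (hm : ∀ j ∉ F, m ≤ x k j) (hM : ∀ j ∉ F, x k j ≤ M) (l : ℕ) :
    above F (x (k + l)) (level V W k M ((M - m) / 2) l) = ∅ ∨
    above F (fun i => -x (k + l) i) (level V W k (-m) ((M - m) / 2) l) = ∅ ∨
    (above F (x (k + l)) (level V W k M ((M - m) / 2) l)).card +
      (above F (fun i => -x (k + l) i) (level V W k (-m) ((M - m) / 2) l)).card + l ≤
      Fintype.card V := by
  -- With half the width, both thresholds start at the midpoint and never cross it, so the two sets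
  -- stay disjoint.
  set ε := (M - m) / 2 with hεdef
  have hε : 0 ≤ ε := by linarith
  have hm' : ∀ j ∉ F, -x k j ≤ -m := fun j hj => neg_le_neg (hm j hj)
  have hdisj : ∀ l, Disjoint (above F (x (k + l)) (level V W k M ε l))
      (above F (fun i => -x (k + l) i) (level V W k (-m) ε l)) := by
    intro l
    rw [Finset.disjoint_left]
    intro i hi hi'
    rw [mem_above, level] at hi hi'
    have hB : 0 ≤ ∑ s ∈ Finset.range l, W (k + s) :=
      Finset.sum_nonneg fun s _ => h.W_nonneg hi.1 _
    have hp : (1 / ((Fintype.card V : ℝ) + 1)) ^ l * ε ≤ 1 * ε := by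
      refine mul_le_mul_of_nonneg_right (pow_le_one₀ (by positivity) ?_) hε
      rw [div_le_one (by positivity)]
      linarith [show (0 : ℝ) ≤ Fintype.card V by positivity]
    linarith [hi.2, hi'.2]
  induction l with
  | zero =>
    right; right
    have := (Finset.card_union_of_disjoint (hdisj 0)).symm.trans_le (Finset.card_le_univ _)
    exact this
  | succ l ih =>
    have s1 := h.above_succ_subset hF (ε := ε) hM l
    have s2 := h.neg.above_succ_subset hF (ε := ε) hm' l
    rcases ih with ih | ih | ih
    · left
      rw [ih] at s1
      exact Finset.subset_empty.mp s1
    · right; left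
      rw [ih] at s2
      exact Finset.subset_empty.mp s2
    · rcases Finset.eq_empty_or_nonempty (above F (x (k + l)) (level V W k M ε l)) with e1 | n1
      · left
        rw [e1] at s1
        exact Finset.subset_empty.mp s1
      rcases Finset.eq_empty_or_nonempty
        (above F (fun i => -x (k + l) i) (level V W k (-m) ε l)) with e2 | n2
      · right; left
        rw [e2] at s2
        exact Finset.subset_empty.mp s2
      right; right
      have c1 := Finset.card_le_card s1
      have c2 := Finset.card_le_card s2
      rcases hrob _ _ n1 n2 (hdisj l) with hr | hr
      · have := h.card_above_succ_lt hF hε hM l hr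
        omega
      · have := h.neg.card_above_succ_lt hF hε hm' l hr
        omega

/-- Whichever set is empty, one end of the range has moved inwards by `(1 / (n + 1)) ^ n * (M - m) /
2`. Noise may push both ends outwards, whence the factor `2`. -/
theorem sub_le_contraction (h : IsTrimmedPath G F f x r W) (hF : F.card ≤ f)
    (hrob : IsRobust G (3 * f + 1)) {k : ℕ} {m M : ℝ} (hmM : m ≤ M)
    (hm : ∀ j ∉ F, m ≤ x k j) (hM : ∀ j ∉ F, x k j ≤ M) {i j : V} (hi : i ∉ F) (hj : j ∉ F) :
    x (k + Fintype.card V) i - x (k + Fintype.card V) j ≤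
      (1 - (1 / ((Fintype.card V : ℝ) + 1)) ^ Fintype.card V / 2) * (M - m) +
        2 * ∑ s ∈ Finset.range (Fintype.card V), W (k + s) := by
  have h1 := h.le_add_sum hF hM (Fintype.card V) i hi
  have h2 := h.neg.le_add_sum hF (M := -m) (fun j hj => neg_le_neg (hm j hj))
    (Fintype.card V) j hj
  have hor : above F (x (k + Fintype.card V))
        (level V W k M ((M - m) / 2) (Fintype.card V)) = ∅ ∨
      above F (fun i => -x (k + Fintype.card V) i)
        (level V W k (-m) ((M - m) / 2) (Fintype.card V)) = ∅ := by
    rcases h.card_above_add_le hF hrob hmM hm hM (Fintype.card V) with he | he | he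
    · exact Or.inl he
    · exact Or.inr he
    -- After `n` steps the count leaves no agent in either set.
    · left
      rw [← Finset.card_eq_zero]
      omega
  rcases hor with he | he
  · have h3 : i ∉ above F (x (k + Fintype.card V))
        (level V W k M ((M - m) / 2) (Fintype.card V)) := by simp [he]
    rw [mem_above, not_and, not_lt, level] at h3
    linarith [h3 hi]
  · have h3 : j ∉ above F (fun i => -x (k + Fintype.card V) i)
        (level V W k (-m) ((M - m) / 2) (Fintype.card V)) := by simp [he]
    rw [mem_above, not_and, not_lt, level] at h3
    linarith [h3 hj]

end IsTrimmedPath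

/-! ### Degree bounds from robustness -/

section Degree

theorem mem_inNbrs {i j : V} : j ∈ inNbrs G i ↔ G.Adj j i := by
  simp [inNbrs]

/-- If `f ≠ 0`, every agent of a `(3 f + 1)`-robust digraph has at least `3 f + 1` in-neighbours. -/
theorem IsRobust.le_card_inNbrs (hrob : IsRobust G (3 * f + 1)) (hn : 2 ≤ Fintype.card V)
    (hf : f ≠ 0) (i : V) : 3 * f + 1 ≤ (inNbrs G i).card := by
  obtain ⟨j, hj⟩ := Fintype.exists_ne_of_one_lt_card hn i
  rcases hrob {i} (Finset.univ \ {i}) (by simp) ⟨j, by simpa using hj⟩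
    Finset.disjoint_sdiff with ⟨l, hl, hle⟩ | ⟨l, -, hle⟩
  · rw [Finset.mem_singleton] at hl
    subst hl
    exact hle.trans (Finset.card_le_card Finset.sdiff_subset)
  -- Only `i` lies outside the complement of `{i}`, so that complement is not reachable when `f ≠
  -- 0`.
  · have : (inNbrs G l \ (Finset.univ \ {i})).card ≤ 1 := by
      rw [← Finset.card_singleton i]
      apply Finset.card_le_card
      intro x hx
      simpa using (Finset.mem_sdiff.mp hx).2
    have hle' : 3 * f + 1 ≤ 1 := hle.trans (by convert this)
    omega

theorem IsRobust.two_mul_le_card (hrob : IsRobust G (3 * f + 1)) (hn : 2 ≤ Fintype.card V)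
    (i : V) : 2 * f ≤ (inNbrs G i).card := by
  by_cases hf : f = 0
  · simp [hf]
  · have := hrob.le_card_inNbrs hn hf i
    omega

theorem IsRobust.lt_card (hrob : IsRobust G (3 * f + 1)) (hn : 2 ≤ Fintype.card V) :
    3 * f + 1 < Fintype.card V := by
  obtain ⟨i, j, hij⟩ := Fintype.exists_pair_of_one_lt_card hn
  have key : ∀ i, IsReachable G (3 * f + 1) {i} → 3 * f + 1 < Fintype.card V := by
    rintro i ⟨l, -, hle⟩
    refine hle.trans_lt (Finset.card_lt_univ_of_notMem (x := i) ?_)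
    simp
  rcases hrob {i} {j} (by simp) (by simp) (by simpa using hij) with h | h
  · exact key i h
  · exact key j h

theorem IsRobust.weight_le (hrob : IsRobust G (3 * f + 1)) (hn : 2 ≤ Fintype.card V)
    {i j : V} (hij : G.Adj j i) : weight G f i ≤ 1 / ((f : ℝ) + 2) := by
  have h1 : 3 * f + 1 ≤ (inNbrs G i).card := by
    -- For `f = 0` an agent may lack in-neighbours; here the edge from `j` supplies one.
    by_cases hf : f = 0
    · have : 0 < (inNbrs G i).card := Finset.card_pos.mpr ⟨j, mem_inNbrs.mpr hij⟩
      omega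
    · exact hrob.le_card_inNbrs hn hf i
  have h2 : ((3 * f + 1 : ℕ) : ℝ) ≤ (inNbrs G i).card := by exact_mod_cast h1
  push_cast at h2
  exact one_div_le_one_div_of_le (by positivity) (by linarith)

end Degree

end Contraction

/-! ### Second moments, an Efron-Stein inequality, the Laplace variance -/

section Variance

variable {Ω : Type*} [MeasurableSpace Ω] {P : Measure Ω}

theorem memLp_two_of_lintegral_sq_lt_top {φ : Ω → ℝ} (hφ : Measurable φ)
    (h : ∫⁻ ω, ENNReal.ofReal (φ ω ^ 2) ∂P < ⊤) : MemLp φ 2 P := by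
  rw [memLp_two_iff_integrable_sq hφ.aestronglyMeasurable]
  refine ⟨(hφ.pow_const 2).aestronglyMeasurable, ?_⟩
  rw [hasFiniteIntegral_iff_ofReal (ae_of_all _ fun ω => sq_nonneg _)]
  exact h

theorem lintegral_sq_eq_ofReal {φ : Ω → ℝ} (hφ : MemLp φ 2 P) :
    ∫⁻ ω, ENNReal.ofReal (φ ω ^ 2) ∂P = ENNReal.ofReal (∫ ω, φ ω ^ 2 ∂P) :=
  (ofReal_integral_eq_lintegral_ofReal hφ.integrable_sq (ae_of_all _ fun _ => sq_nonneg _)).symm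

variable [IsProbabilityMeasure P]

theorem integral_sub_sq {φ : Ω → ℝ} (hφ : MemLp φ 2 P) (c : ℝ) :
    ∫ ω, (φ ω - c) ^ 2 ∂P = ∫ ω, φ ω ^ 2 ∂P - 2 * c * ∫ ω, φ ω ∂P + c ^ 2 := by
  have h1 : Integrable φ P := hφ.integrable one_le_two
  have h2 := hφ.integrable_sq
  have : ∀ ω, (φ ω - c) ^ 2 = φ ω ^ 2 - 2 * c * φ ω + c ^ 2 := fun ω => by ring
  simp_rw [this]
  rw [integral_add (f := fun ω => φ ω ^ 2 - 2 * c * φ ω) (h2.sub (h1.const_mul _)) (integrable_const _),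
    integral_sub h2 (h1.const_mul _), integral_const_mul]
  simp

theorem memLp_two_of_sub_sq_le {φ : Ω → ℝ} (hφ : Measurable φ) {b C : ℝ} {D : Ω → ℝ}
    (hb : ∀ ω, (φ ω - b) ^ 2 ≤ D ω) (hD : ∫⁻ ω, ENNReal.ofReal (D ω) ∂P ≤ ENNReal.ofReal C) :
    MemLp φ 2 P := by
  have h1 : MemLp (fun ω => φ ω - b) 2 P :=
    memLp_two_of_lintegral_sq_lt_top (hφ.sub_const b)
      (((lintegral_mono fun ω => ENNReal.ofReal_le_ofReal (hb ω)).trans hD).trans_lt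
        ENNReal.ofReal_lt_top)
  have h2 := h1.add (memLp_const b)
  convert h2 using 1
  ext ω
  simp

/-- The mean minimises the second moment about a constant, so the variance is at most `C`; what
remains is the squared bias. -/
theorem lintegral_sub_sq_le {φ : Ω → ℝ} (hφ : Measurable φ) {b C : ℝ} {D : Ω → ℝ}
    (hb : ∀ ω, (φ ω - b) ^ 2 ≤ D ω) (hC : 0 ≤ C)
    (hD : ∫⁻ ω, ENNReal.ofReal (D ω) ∂P ≤ ENNReal.ofReal C) (c : ℝ) :
    ∫⁻ ω, ENNReal.ofReal ((φ ω - c) ^ 2) ∂P ≤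
      ENNReal.ofReal C + ENNReal.ofReal ((∫ ω, φ ω ∂P - c) ^ 2) := by
  have hL := memLp_two_of_sub_sq_le hφ hb hD
  have hLc : ∀ t : ℝ, MemLp (fun ω => φ ω - t) 2 P := fun t => hL.sub (memLp_const t)
  have hbC : ∫ ω, (φ ω - b) ^ 2 ∂P ≤ C := by
    rw [← ENNReal.ofReal_le_ofReal_iff hC, ← lintegral_sq_eq_ofReal (hLc b)]
    exact (lintegral_mono fun ω => ENNReal.ofReal_le_ofReal (hb ω)).trans hD
  rw [lintegral_sq_eq_ofReal (hLc c), ← ENNReal.ofReal_add hC (sq_nonneg _)]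
  apply ENNReal.ofReal_le_ofReal
  rw [integral_sub_sq hL] at hbC ⊢
  nlinarith [sq_nonneg (∫ ω, φ ω ∂P - b)]

/-- The bounded differences form of the Efron-Stein inequality: if replacing the `a`-th argument
`x` of `g` by `0` changes the value by at most `√(D a x)`, then the variance of `g` at independent
arguments `X a` is at most the sum of the expected values of `D a (X a)`. -/
theorem exists_lintegral_sub_sq_le_sum {ι E : Type*} [DecidableEq ι] [MeasurableSpace E] [Zero E]
    {X : ι → Ω → E} (hX : ∀ a, Measurable (X a)) (hindep : iIndepFun X P)
    {D : ι → E → ℝ} {C : ι → ℝ} (hC : ∀ a, 0 ≤ C a)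
    (hD : ∀ a, ∫⁻ ω, ENNReal.ofReal (D a (X a ω)) ∂P ≤ ENNReal.ofReal (C a)) (s : Finset ι) :
    ∀ g : (ι → E) → ℝ, Measurable g →
      (∀ a y x, (g (Function.update y a x) - g (Function.update y a 0)) ^ 2 ≤ D a x) →
      ∃ c : ℝ, ∫⁻ ω, ENNReal.ofReal ((g (fun a => if a ∈ s then X a ω else 0) - c) ^ 2) ∂P ≤
        ENNReal.ofReal (∑ a ∈ s, C a) := by
  induction s using Finset.induction_on with
  | empty => exact fun g _ _ => ⟨g (fun _ => 0), by simp⟩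
  | insert a s ha ih =>
    intro g hg hgD
    set Y : Ω → ι → E := fun ω b => if b ∈ s then X b ω else 0 with hY
    have hYm : Measurable Y := measurable_pi_iff.mpr fun b => by
      by_cases hb : b ∈ s
      · simpa [hY, hb] using hX b
      · simp [hY, hb]
    have hupd : Measurable fun p : (ι → E) × E => g (Function.update p.1 a p.2) :=
      hg.comp measurable_update'
    have hφ : ∀ y, Measurable fun ω => g (Function.update y a (X a ω)) := fun y =>
      hupd.comp (measurable_const.prodMk (hX a))
    have hLp : ∀ y, MemLp (fun ω => g (Function.update y a (X a ω))) 2 P := fun y =>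
      memLp_two_of_sub_sq_le (hφ y) (fun ω => hgD a y (X a ω)) (hD a)
    have hint : ∀ y, Integrable (fun ω => g (Function.update y a (X a ω))) P := fun y =>
      (hLp y).integrable one_le_two
    -- Integrating out the `a`-th argument preserves the difference bounds, so the induction
    -- hypothesis applies to the average.
    obtain ⟨c, hc⟩ := ih (fun y => ∫ ω, g (Function.update y a (X a ω)) ∂P) (by
        have : Measurable fun p : (ι → E) × Ω => g (Function.update p.1 a (X a p.2)) :=
          hupd.comp (measurable_fst.prodMk ((hX a).comp measurable_snd))
        exact this.stronglyMeasurable.integral_prod_right.measurable) (by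
        intro b y x
        have hDnn : 0 ≤ D b x := (sq_nonneg _).trans (hgD b y x)
        -- The average does not depend on its own `a`-th argument.
        by_cases hba : b = a
        · subst hba
          simpa using hDnn
        · have hcomm : ∀ z ω, Function.update (Function.update y b z) a (X a ω) =
              Function.update (Function.update y a (X a ω)) b z := fun z ω =>
            Function.update_comm hba _ _ _
          rw [← integral_sub (hint _) (hint _)]
          simp_rw [hcomm]
          rw [← Real.sq_sqrt hDnn, sq_le_sq, abs_of_nonneg (Real.sqrt_nonneg _)]
          have hle : ∀ ω, ‖g (Function.update (Function.update y a (X a ω)) b x) -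
              g (Function.update (Function.update y a (X a ω)) b 0)‖ ≤ √(D b x) := fun ω =>
            Real.abs_le_sqrt (hgD b _ x)
          simpa using norm_integral_le_of_norm_le_const (μ := P) (ae_of_all _ hle))
    refine ⟨c, ?_⟩
    have hins : ∀ ω, (fun b => if b ∈ insert a s then X b ω else 0) =
        Function.update (Y ω) a (X a ω) := by
      intro ω
      ext b
      by_cases hba : b = a
      · subst hba; simp
      · simp [hY, hba]
    have hind : IndepFun Y (X a) P := by
      have h1 := hindep.indepFun_finset s {a} (Finset.disjoint_singleton_right.mpr ha) hX
      have h2 : Measurable fun (z : (i : s) → E) (b : ι) =>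
          if hb : b ∈ s then z ⟨b, hb⟩ else 0 := measurable_pi_iff.mpr fun b => by
        by_cases hb : b ∈ s
        · simpa [hb] using measurable_pi_apply _
        · simp [hb]
      have h3 : Measurable fun z : (i : ({a} : Finset ι)) → E => z ⟨a, by simp⟩ :=
        measurable_pi_apply _
      have h4 := h1.comp h2 h3
      convert h4 using 1
      · ext ω b
        simp [hY]
      · rfl
    -- By independence the second moment becomes an iterated integral, the inner one over `X a` with
    -- `Y` frozen.
    have hprod := (indepFun_iff_map_prod_eq_prod_map_map hYm.aemeasurable
      (hX a).aemeasurable).mp hind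
    have hsq : Measurable fun p : (ι → E) × E =>
        ENNReal.ofReal ((g (Function.update p.1 a p.2) - c) ^ 2) :=
      ((hupd.sub_const c).pow_const 2).ennreal_ofReal
    have hprobY : IsProbabilityMeasure (P.map Y) := Measure.isProbabilityMeasure_map hYm.aemeasurable
    have hprobX : IsProbabilityMeasure (P.map (X a)) :=
      Measure.isProbabilityMeasure_map (hX a).aemeasurable
    calc ∫⁻ ω, ENNReal.ofReal ((g (fun b => if b ∈ insert a s then X b ω else 0) - c) ^ 2) ∂P
        = ∫⁻ ω, ENNReal.ofReal ((g (Function.update (Y ω) a (X a ω)) - c) ^ 2) ∂P := by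
          simp_rw [hins]
      _ = ∫⁻ p, ENNReal.ofReal ((g (Function.update p.1 a p.2) - c) ^ 2)
            ∂(P.map fun ω => (Y ω, X a ω)) := by
          rw [lintegral_map hsq (hYm.prodMk (hX a))]
      _ = ∫⁻ ω, ∫⁻ ω', ENNReal.ofReal ((g (Function.update (Y ω) a (X a ω')) - c) ^ 2) ∂P ∂P := by
          rw [hprod, lintegral_prod _ hsq.aemeasurable,
            lintegral_map hsq.lintegral_prod_right' hYm]
          refine lintegral_congr fun ω => ?_
          exact lintegral_map (hsq.comp (measurable_prodMk_left (x := Y ω))) (hX a)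
      _ ≤ ∫⁻ ω, (ENNReal.ofReal (C a) + ENNReal.ofReal
            ((∫ ω', g (Function.update (Y ω) a (X a ω')) ∂P - c) ^ 2)) ∂P :=
          lintegral_mono fun ω =>
            lintegral_sub_sq_le (hφ _) (fun ω' => hgD a _ (X a ω')) (hC a) (hD a) c
      _ = ENNReal.ofReal (C a) + ∫⁻ ω, ENNReal.ofReal
            ((∫ ω', g (Function.update (Y ω) a (X a ω')) ∂P - c) ^ 2) ∂P := by
          rw [lintegral_add_left measurable_const]
          simp
      _ ≤ ENNReal.ofReal (C a) + ENNReal.ofReal (∑ b ∈ s, C b) := by gcongr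
      _ = ENNReal.ofReal (∑ b ∈ insert a s, C b) := by
          rw [Finset.sum_insert ha, ENNReal.ofReal_add (hC a) (Finset.sum_nonneg fun b _ => hC b)]

theorem integral_sq_mul_laplace_density {b : ℝ} (hb : 0 < b) :
    ∫ x : ℝ, x ^ 2 * (1 / (2 * b) * Real.exp (-|x| / b)) = 2 * b ^ 2 := by
  have h1 := integral_comp_abs (f := fun x => x ^ 2 * (1 / (2 * b) * Real.exp (-x / b)))
  simp only [sq_abs] at h1
  rw [h1]
  have h2 := Real.integral_rpow_mul_exp_neg_mul_Ioi (a := 3) (r := 1 / b) (by norm_num)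
    (by positivity)
  have h3 : ∫ x in Set.Ioi (0 : ℝ), x ^ 2 * (1 / (2 * b) * Real.exp (-x / b)) =
      1 / (2 * b) * ∫ t in Set.Ioi (0 : ℝ), t ^ ((3 : ℝ) - 1) * Real.exp (-(1 / b * t)) := by
    rw [← integral_const_mul]
    refine setIntegral_congr_fun measurableSet_Ioi fun t _ => ?_
    have e1 : t ^ ((3 : ℝ) - 1) = t ^ 2 := by
      rw [show (3 : ℝ) - 1 = ((2 : ℕ) : ℝ) by norm_num, Real.rpow_natCast]
    have e2 : -(1 / b * t) = -t / b := by ring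
    simp only [e1, e2]
    ring
  have hG : Real.Gamma 3 = 2 := by
    rw [show (3 : ℝ) = ((2 : ℕ) : ℝ) + 1 by norm_num, Real.Gamma_nat_eq_factorial]
    norm_num [Nat.factorial]
  have e3 : (1 / (1 / b)) ^ (3 : ℝ) = b ^ 3 := by
    rw [one_div_one_div, show (3 : ℝ) = ((3 : ℕ) : ℝ) by norm_num, Real.rpow_natCast]
  rw [h3, h2, hG, e3]
  field_simp

theorem lintegral_sq_laplace {b : ℝ} (hb : 0 < b) :
    ∫⁻ x, ENNReal.ofReal (x ^ 2) ∂(laplace b) = ENNReal.ofReal (2 * b ^ 2) := by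
  have hint := integral_sq_mul_laplace_density hb
  have hm : Measurable fun x : ℝ => ENNReal.ofReal (1 / (2 * b) * Real.exp (-|x| / b)) := by
    fun_prop
  rw [laplace, lintegral_withDensity_eq_lintegral_mul _ hm (by fun_prop), ← hint,
    ofReal_integral_eq_lintegral_ofReal]
  · refine lintegral_congr fun x => ?_
    rw [Pi.mul_apply, mul_comm, ← ENNReal.ofReal_mul (sq_nonneg x)]
  -- A non-integrable function has integral `0` by convention, against the value `2 * b ^ 2`.
  · by_contra hcon
    rw [integral_undef hcon] at hint
    have : 0 < b ^ 2 := by positivity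
    linarith
  · exact ae_of_all _ fun x => by positivity

end Variance

/-! ### The states as a function of the noise -/

section Flow

open scoped Classical

variable {V : Type*} [Fintype V]

/-- The value that `i` receives from `j` when the states are `y` and the noise is `w`. -/
def received (F : Finset V) (θhat : ℕ → V → V → ℝ) (w : ℕ × V → V → ℝ) (k : ℕ) (y : V → ℝ)
    (i j : V) : ℝ :=
  (if j ∈ F then θhat k j i else y j) + (if j ∈ F then w (k, j) i else w (k, j) j)

/-- The states of all agents as a function of the noise `w`. -/
def flow (G : Digraph V) (F : Finset V) (f : ℕ) (θhat : ℕ → V → V → ℝ) (θ₀ : V → ℝ)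
    (w : ℕ × V → V → ℝ) : ℕ → V → ℝ
  | 0 => θ₀
  | k + 1 => fun i => weight G f i * flow G F f θhat θ₀ w k i +
      weight G f i * trimmedSum f (inNbrs G i)
        (received F θhat w k (flow G F f θhat θ₀ w k) i)

variable {G : Digraph V} {F : Finset V} {f : ℕ} {θhat : ℕ → V → V → ℝ} {θ₀ : V → ℝ}

/-- Noise vectors are indexed by recipients. A non-faulty sender has a constant vector, of which
`received` reads the sender's own entry. The flow also moves faulty agents, but no message uses
their states. -/
theorem IsExecution.eq_flow {Ω : Type*} {η : ℕ → V → Ω → ℝ} {ηhat : ℕ → V → V → Ω → ℝ}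
    {θ : ℕ → V → Ω → ℝ} (h : IsExecution G F f θhat η ηhat θ₀ θ) (ω : Ω) (k : ℕ) :
    ∀ i ∉ F, θ k i ω =
      flow G F f θhat θ₀ (fun a => noise F η ηhat a.1 a.2 ω) k i := by
  induction k with
  | zero => exact fun i hi => h.init i hi ω
  | succ k ih =>
    intro i hi
    obtain ⟨S, hS, hθ⟩ := h.step k i hi ω
    have hmsg : (fun j => message F θhat η ηhat θ k j i ω) =
        received F θhat (fun a => noise F η ηhat a.1 a.2 ω) k
          (flow G F f θhat θ₀ (fun a => noise F η ηhat a.1 a.2 ω) k) i := by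
      ext j
      by_cases hj : j ∈ F
      · simp [message, received, hj]
      · simp [message, received, hj, ih j hj, noise]
    rw [hθ, ← Finset.mul_sum, hS.sum_eq, hmsg, ih i hi]
    rfl

theorem measurable_flow (hcard : ∀ i, 2 * f ≤ (inNbrs G i).card) (k : ℕ) :
    Measurable fun w => flow G F f θhat θ₀ w k := by
  induction k with
  | zero => exact measurable_const
  | succ k ih =>
    refine measurable_pi_iff.mpr fun i => ?_
    have hy : ∀ j, Measurable fun w => flow G F f θhat θ₀ w k j := fun j =>
      (measurable_pi_apply j).comp ih
    have hw : ∀ (a : ℕ × V) (j : V), Measurable fun w : ℕ × V → V → ℝ => w a j := fun a j =>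
      (measurable_pi_apply j).comp (measurable_pi_apply a)
    refine ((hy i).const_mul _).add (Measurable.const_mul ?_ _)
    refine (continuous_trimmedSum (hcard i)).measurable.comp (measurable_pi_iff.mpr fun j => ?_)
    by_cases hj : j ∈ F
    · simpa [received, hj] using (hw (k, j) i).const_add _
    · simp only [received, hj, if_false]
      exact (hy j).add (hw (k, j) j)

theorem flow_congr {w w' : ℕ × V → V → ℝ} (k : ℕ) (h : ∀ l < k, ∀ j, w (l, j) = w' (l, j)) :
    flow G F f θhat θ₀ w k = flow G F f θhat θ₀ w' k := by
  induction k with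
  | zero => rfl
  | succ k ih =>
    have h1 := ih fun l hl => h l (by omega)
    have h2 : received F θhat w k = received F θhat w' k := by
      funext y i j
      simp [received, h k (by omega) j]
    simp only [flow, h1, h2]

/-- Each trimmed sum changes by at most `B.card * δ`, and the weights sum to one: the update is
nonexpansive in the sup norm. -/
theorem abs_flow_succ_sub_le (hcard : ∀ i, 2 * f ≤ (inNbrs G i).card) {w w' : ℕ × V → V → ℝ}
    {k : ℕ} {δ : ℝ} (h : ∀ j, |flow G F f θhat θ₀ w k j - flow G F f θhat θ₀ w' k j| ≤ δ)
    (hw : ∀ j, w (k, j) = w' (k, j)) (i : V) :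
    |flow G F f θhat θ₀ w (k + 1) i - flow G F f θhat θ₀ w' (k + 1) i| ≤ δ := by
  have hδ : 0 ≤ δ := (abs_nonneg _).trans (h i)
  have hpos := weight_pos (hcard i)
  obtain ⟨B, -, hB, hle⟩ := abs_trimmedSum_sub_le (hcard i)
    (received F θhat w k (flow G F f θhat θ₀ w k) i)
    (received F θhat w' k (flow G F f θhat θ₀ w' k) i)
  have hsum : ∑ j ∈ B, |received F θhat w k (flow G F f θhat θ₀ w k) i j -
      received F θhat w' k (flow G F f θhat θ₀ w' k) i j| ≤ B.card * δ := by
    rw [← nsmul_eq_mul]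
    refine Finset.sum_le_card_nsmul _ _ _ fun j _ => ?_
    by_cases hj : j ∈ F
    · simpa [received, hj, hw j] using hδ
    · simpa [received, hj, hw j] using h j
  have hw1 := weight_mul_card hB
  calc |flow G F f θhat θ₀ w (k + 1) i - flow G F f θhat θ₀ w' (k + 1) i|
      = weight G f i * |(flow G F f θhat θ₀ w k i - flow G F f θhat θ₀ w' k i) +
          (trimmedSum f (inNbrs G i) (received F θhat w k (flow G F f θhat θ₀ w k) i) -
          trimmedSum f (inNbrs G i) (received F θhat w' k (flow G F f θhat θ₀ w' k) i))| := by
        rw [← abs_of_pos hpos, ← abs_mul]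
        simp only [flow]
        congr 1
        ring
    _ ≤ weight G f i * (δ + B.card * δ) := by
        gcongr
        exact (abs_add_le _ _).trans (add_le_add (h i) (hle.trans hsum))
    _ = δ := by linear_combination δ * hw1

/-- A bound for the square of the effect that the noise `x` of agent `a.2` at time `a.1` has on the
later states. -/
def influence (G : Digraph V) (F : Finset V) (f : ℕ) (a : ℕ × V) (x : V → ℝ) : ℝ :=
  (1 / ((f : ℝ) + 2)) ^ 2 *
    if a.2 ∈ F then ∑ i ∈ Finset.univ.filter fun i => G.Adj a.2 i, x i ^ 2 else x a.2 ^ 2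

theorem influence_nonneg (a : ℕ × V) (x : V → ℝ) : 0 ≤ influence G F f a x := by
  unfold influence
  split_ifs <;> positivity

theorem abs_flow_update_sub_le_of_succ (hrob : IsRobust G (3 * f + 1))
    (hn : 2 ≤ Fintype.card V) (a : ℕ × V) (w : ℕ × V → V → ℝ) (x : V → ℝ) (i : V) :
    |flow G F f θhat θ₀ (Function.update w a x) (a.1 + 1) i -
      flow G F f θhat θ₀ (Function.update w a 0) (a.1 + 1) i| ≤ √(influence G F f a x) := by
  obtain ⟨k, j⟩ := a
  have hcard := hrob.two_mul_le_card hn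
  have hpos := weight_pos (hcard i)
  have heq : flow G F f θhat θ₀ (Function.update w (k, j) x) k =
      flow G F f θhat θ₀ (Function.update w (k, j) 0) k := by
    refine flow_congr k fun l hl m => ?_
    have : (l, m) ≠ (k, j) := fun h => hl.ne (Prod.ext_iff.mp h).1
    simp [this]
  set y := flow G F f θhat θ₀ (Function.update w (k, j) 0) k with hy
  set v : ℝ := if j ∈ F then x i else x j with hv
  obtain ⟨B, hBN, -, hle⟩ := abs_trimmedSum_sub_le (hcard i)
    (received F θhat (Function.update w (k, j) x) k y i)
    (received F θhat (Function.update w (k, j) 0) k y i)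
  have hterm : ∀ m, |received F θhat (Function.update w (k, j) x) k y i m -
      received F θhat (Function.update w (k, j) 0) k y i m| = if m = j then |v| else 0 := by
    intro m
    by_cases hm : m = j
    · subst hm
      by_cases hF : m ∈ F <;> simp [received, hv, hF]
    · have : (k, m) ≠ (k, j) := fun h => hm (Prod.ext_iff.mp h).2
      simp [received, hm, this]
  simp_rw [hterm, Finset.sum_ite_eq'] at hle
  have hdiff : |flow G F f θhat θ₀ (Function.update w (k, j) x) (k + 1) i -
      flow G F f θhat θ₀ (Function.update w (k, j) 0) (k + 1) i| =
      weight G f i * |trimmedSum f (inNbrs G i)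
          (received F θhat (Function.update w (k, j) x) k y i) -
        trimmedSum f (inNbrs G i) (received F θhat (Function.update w (k, j) 0) k y i)| := by
    rw [← abs_of_pos hpos, ← abs_mul]
    simp only [flow, heq, ← hy]
    congr 1
    ring
  rw [hdiff]
  by_cases hadj : G.Adj j i
  · have hv2 : (1 / ((f : ℝ) + 2) * |v|) ^ 2 ≤ influence G F f (k, j) x := by
      rw [mul_pow, sq_abs, influence]
      refine mul_le_mul_of_nonneg_left ?_ (by positivity)
      -- Recipient `i` sees only its own entry of a faulty sender's noise. Summing the squares over
      -- all out-neighbours gives a bound uniform in `i`.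
      by_cases hF : j ∈ F
      · simp only [hv, hF, if_true]
        exact Finset.single_le_sum (f := fun i => x i ^ 2) (fun _ _ => sq_nonneg _)
          (by simpa using hadj)
      · simp [hv, hF]
    refine le_trans ?_ (Real.le_sqrt_of_sq_le hv2)
    have h1 : (if j ∈ B then |v| else 0) ≤ |v| := by
      split_ifs
      · exact le_rfl
      · exact abs_nonneg v
    exact mul_le_mul (hrob.weight_le hn hadj) (hle.trans h1) (abs_nonneg _) (by positivity)
  · have hjB : j ∉ B := fun h => hadj (mem_inNbrs.mp (hBN h))
    rw [if_neg hjB] at hle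
    rw [le_antisymm hle (abs_nonneg _), mul_zero]
    exact Real.sqrt_nonneg _

/-- A noise has no effect until it is sent, a bounded effect one step later, and nonexpansiveness
keeps that bound afterwards. -/
theorem flow_update_sub_sq_le (hrob : IsRobust G (3 * f + 1)) (hn : 2 ≤ Fintype.card V)
    (k : ℕ) (i : V) (a : ℕ × V) (w : ℕ × V → V → ℝ) (x : V → ℝ) :
    (flow G F f θhat θ₀ (Function.update w a x) k i -
      flow G F f θhat θ₀ (Function.update w a 0) k i) ^ 2 ≤ influence G F f a x := by
  have hne : ∀ l m, l ≠ a.1 → Function.update w a x (l, m) = Function.update w a 0 (l, m) := by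
    intro l m hl
    have : (l, m) ≠ a := fun h => hl (by rw [← h])
    simp [this]
  rcases le_or_gt k a.1 with hk | hk
  · rw [flow_congr k fun l hl m => hne l m (by omega), sub_self]
    simpa using influence_nonneg a x
  · have key : ∀ l, a.1 + 1 ≤ l → ∀ i, |flow G F f θhat θ₀ (Function.update w a x) l i -
        flow G F f θhat θ₀ (Function.update w a 0) l i| ≤ √(influence G F f a x) := by
      intro l hl
      induction l, hl using Nat.le_induction with
      | base => exact abs_flow_update_sub_le_of_succ hrob hn a w x
      | succ l hl ih =>
        exact abs_flow_succ_sub_le (hrob.two_mul_le_card hn) ih fun m => hne l m (by omega)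
    rw [← sq_abs, ← Real.sq_sqrt (influence_nonneg a x)]
    exact pow_le_pow_left₀ (abs_nonneg _) (key k hk i) 2

end Flow

/-! ### Summing the influences of all noises -/

section NoiseVariance

open scoped Classical

variable {V : Type*} {G : Digraph V} {F : Finset V} {f : ℕ}
  {Ω : Type*} [MeasurableSpace Ω] {P : Measure Ω}
  {η : ℕ → V → Ω → ℝ} {ηhat : ℕ → V → V → Ω → ℝ}

theorem measurable_noise (hη : ∀ k, ∀ i ∉ F, Measurable (η k i))
    (hηhat : ∀ k, ∀ i ∈ F, ∀ j, Measurable (ηhat k i j)) (a : ℕ × V) :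
    Measurable fun ω => noise F η ηhat a.1 a.2 ω := by
  refine measurable_pi_iff.mpr fun i => ?_
  by_cases h : a.2 ∈ F
  · simpa [noise, h] using hηhat a.1 a.2 h i
  · simpa [noise, h] using hη a.1 a.2 h

theorem lintegral_sq_of_map_laplace {X : Ω → ℝ} (hX : Measurable X) {b : ℝ} (hb : 0 < b)
    (hlaw : P.map X = laplace b) :
    ∫⁻ ω, ENNReal.ofReal (X ω ^ 2) ∂P = ENNReal.ofReal (2 * b ^ 2) := by
  rw [← lintegral_sq_laplace hb, ← hlaw, lintegral_map (by fun_prop) hX]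

variable [Fintype V]

/-- The number of different noises that agent `j` emits at a time, as far as they matter. -/
def multiplicity (G : Digraph V) (F : Finset V) (j : V) : ℝ :=
  if j ∈ F then ((Finset.univ.filter fun i => G.Adj j i).card : ℝ) else 1

theorem multiplicity_nonneg (j : V) : 0 ≤ multiplicity G F j := by
  unfold multiplicity
  split_ifs <;> positivity

theorem lintegral_influence_le {k : ℕ} {b : ℝ} (hb : 0 < b)
    (hη_meas : ∀ i ∉ F, Measurable (η k i))
    (hη_law : ∀ i ∉ F, P.map (η k i) = laplace b)
    (hηhat_memLp : ∀ i ∈ F, ∀ j, G.Adj i j → MemLp (ηhat k i j) 2 P)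
    (hηhat_mean : ∀ i ∈ F, ∀ j, G.Adj i j → ∫ ω, ηhat k i j ω ∂P = 0)
    (hηhat_var : ∀ i ∈ F, ∀ j, G.Adj i j → Var[ηhat k i j; P] ≤ 2 * b ^ 2) (j : V) :
    ∫⁻ ω, ENNReal.ofReal (influence G F f (k, j) (noise F η ηhat k j ω)) ∂P ≤
      ENNReal.ofReal ((1 / ((f : ℝ) + 2)) ^ 2 * (multiplicity G F j * (2 * b ^ 2))) := by
  have hL : (0 : ℝ) ≤ (1 / ((f : ℝ) + 2)) ^ 2 := by positivity
  simp_rw [influence, ENNReal.ofReal_mul hL]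
  rw [lintegral_const_mul' _ _ ENNReal.ofReal_ne_top]
  gcongr
  by_cases hj : j ∈ F
  · simp only [hj, if_true, noise, multiplicity]
    have hint : ∀ i ∈ Finset.univ.filter fun i => G.Adj j i,
        Integrable (fun ω => ηhat k j i ω ^ 2) P := fun i hi =>
      (hηhat_memLp j hj i (by simpa using hi)).integrable_sq
    rw [← ofReal_integral_eq_lintegral_ofReal (integrable_finsetSum _ hint)
      (ae_of_all _ fun ω => Finset.sum_nonneg fun _ _ => sq_nonneg _)]
    apply ENNReal.ofReal_le_ofReal
    rw [integral_finsetSum _ hint, ← nsmul_eq_mul]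
    refine Finset.sum_le_card_nsmul _ _ _ fun i hi => ?_
    have hadj : G.Adj j i := by simpa using hi
    have h1 := hηhat_var j hj i hadj
    rwa [variance_of_integral_eq_zero (hηhat_memLp j hj i hadj).aemeasurable
      (hηhat_mean j hj i hadj)] at h1
  · simp only [hj, if_false, noise, multiplicity, one_mul]
    exact (lintegral_sq_of_map_laplace (hη_meas j hj) hb (hη_law j hj)).le

theorem sum_multiplicity_le (hloop : ∀ i, ¬ G.Adj i i) (hF : F.card ≤ f)
    (hn : 3 * f + 1 < Fintype.card V) :
    (1 / ((f : ℝ) + 2)) ^ 2 * ∑ j, multiplicity G F j ≤ ((Fintype.card V : ℝ) - f) / 4 := by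
  have hn' : (3 * f + 2 : ℝ) ≤ Fintype.card V := by exact_mod_cast hn
  have hF' : (F.card : ℝ) ≤ f := by exact_mod_cast hF
  have hf : (0 : ℝ) ≤ f := by positivity
  have hj : ∀ j, multiplicity G F j ≤ 1 + if j ∈ F then ((Fintype.card V : ℝ) - 2) else 0 := by
    intro j
    by_cases hj : j ∈ F
    · simp only [multiplicity, hj, if_true]
      have h1 : (Finset.univ.filter fun i => G.Adj j i).card < Fintype.card V :=
        Finset.card_lt_univ_of_notMem (x := j) (by simpa using hloop j)
      have h2 : ((Finset.univ.filter fun i => G.Adj j i).card : ℝ) + 1 ≤ Fintype.card V := by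
        exact_mod_cast h1
      linarith
    · simp [multiplicity, hj]
  have hsum : ∑ j, multiplicity G F j ≤
      Fintype.card V + F.card * ((Fintype.card V : ℝ) - 2) := by
    refine (Finset.sum_le_sum fun j _ => hj j).trans ?_
    simp [Finset.sum_add_distrib, Finset.sum_ite_mem, mul_sub]
  have hle : ∑ j, multiplicity G F j ≤
      Fintype.card V + f * ((Fintype.card V : ℝ) - 2) :=
    hsum.trans (by gcongr; linarith)
  rw [one_div, inv_pow, inv_mul_le_iff₀ (by positivity)]
  refine hle.trans ?_
  -- The difference `(f + 2)^2 (n - f) - 4 (n + f (n - 2))` equals `f^2 (n - 3 f - 2) + 2 f^2 (f -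
  -- 1) + 4 f`.
  have h0 : 0 ≤ (f : ℝ) ^ 2 * ((Fintype.card V : ℝ) - (3 * f + 2)) :=
    mul_nonneg (sq_nonneg _) (by linarith)
  rcases Nat.eq_zero_or_pos f with h | h
  · subst h; norm_num; linarith
  · have : (1 : ℝ) ≤ f := by exact_mod_cast h
    nlinarith [mul_nonneg hf hf, mul_nonneg (mul_nonneg hf hf) hf]

theorem sum_range_mul_pow_sq_le {c q : ℝ} (hq0 : 0 < q) (hq1 : q < 1) (K : ℕ) :
    ∑ k ∈ Finset.range K, 2 * (c * q ^ k) ^ 2 ≤ 2 * c ^ 2 / (1 - q ^ 2) := by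
  have h1 : q ^ 2 < 1 := by nlinarith
  have h2 := (summable_geometric_of_lt_one (sq_nonneg q) h1).sum_le_tsum (Finset.range K)
    fun _ _ => by positivity
  rw [tsum_geometric_of_lt_one (sq_nonneg q) h1] at h2
  calc ∑ k ∈ Finset.range K, 2 * (c * q ^ k) ^ 2
      = 2 * c ^ 2 * ∑ k ∈ Finset.range K, (q ^ 2) ^ k := by
        rw [Finset.mul_sum]
        refine Finset.sum_congr rfl fun k _ => ?_
        rw [mul_pow, ← pow_mul, ← pow_mul, mul_comm k 2]
        ring
    _ ≤ 2 * c ^ 2 * (1 - q ^ 2)⁻¹ := by gcongr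
    _ = _ := by rw [div_eq_mul_inv]

theorem IsExecution.exists_lintegral_sub_sq_le [IsProbabilityMeasure P]
    (hloop : ∀ i, ¬ G.Adj i i)
    (hn : 2 ≤ Fintype.card V) (hrob : IsRobust G (3 * f + 1)) (hF : F.card ≤ f)
    {c q : ℝ} (hc : 0 < c) (hq0 : 0 < q) (hq1 : q < 1)
    (hη_meas : ∀ k, ∀ i ∉ F, Measurable (η k i))
    (hη_law : ∀ k, ∀ i ∉ F, P.map (η k i) = laplace (c * q ^ k))
    (hηhat_meas : ∀ k, ∀ i ∈ F, ∀ j, Measurable (ηhat k i j))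
    (hηhat_memLp : ∀ k, ∀ i ∈ F, ∀ j, G.Adj i j → MemLp (ηhat k i j) 2 P)
    (hηhat_mean : ∀ k, ∀ i ∈ F, ∀ j, G.Adj i j → ∫ ω, ηhat k i j ω ∂P = 0)
    (hηhat_var : ∀ k, ∀ i ∈ F, ∀ j, G.Adj i j → Var[ηhat k i j; P] ≤ 2 * (c * q ^ k) ^ 2)
    (hindep : iIndepFun (fun (a : ℕ × V) (ω : Ω) => noise F η ηhat a.1 a.2 ω) P)
    {θhat : ℕ → V → V → ℝ} {θ₀ : V → ℝ} {θ : ℕ → V → Ω → ℝ}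
    (h : IsExecution G F f θhat η ηhat θ₀ θ) {i : V} (hi : i ∉ F) (k : ℕ) :
    ∃ m : ℝ, ∫⁻ ω, ENNReal.ofReal ((θ k i ω - m) ^ 2) ∂P ≤
      ENNReal.ofReal (c ^ 2 * ((Fintype.card V : ℝ) - f) / (2 * (1 - q ^ 2))) := by
  set C : ℕ × V → ℝ := fun a =>
    (1 / ((f : ℝ) + 2)) ^ 2 * (multiplicity G F a.2 * (2 * (c * q ^ a.1) ^ 2)) with hC
  have hC0 : ∀ a, 0 ≤ C a := fun a => by
    have := multiplicity_nonneg (G := G) (F := F) a.2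
    positivity
  obtain ⟨m, hm⟩ := exists_lintegral_sub_sq_le_sum (measurable_noise hη_meas hηhat_meas) hindep
    (D := influence G F f) hC0
    (fun a => lintegral_influence_le (k := a.1) (by positivity) (hη_meas _) (hη_law _)
      (hηhat_memLp _) (hηhat_mean _) (hηhat_var _) a.2)
    (Finset.range k ×ˢ Finset.univ) (fun w => flow G F f θhat θ₀ w k i)
    ((measurable_pi_apply i).comp (measurable_flow (hrob.two_mul_le_card hn) k))
    (fun a w x => flow_update_sub_sq_le hrob hn k i a w x)
  refine ⟨m, ?_⟩
  -- Noises from time `k` on do not affect the state at time `k`, so they may be replaced by zero.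
  have heq : ∀ ω, θ k i ω = flow G F f θhat θ₀ (fun a =>
      if a ∈ Finset.range k ×ˢ (Finset.univ : Finset V) then noise F η ηhat a.1 a.2 ω else 0)
      k i := by
    intro ω
    rw [h.eq_flow ω k i hi]
    refine congrFun (flow_congr k fun l hl j => ?_) i
    simp [hl]
  simp_rw [heq]
  refine hm.trans (ENNReal.ofReal_le_ofReal ?_)
  have hq2 : 0 < 1 - q ^ 2 := by nlinarith
  have h1 := sum_multiplicity_le (G := G) hloop hF (hrob.lt_card hn)
  have h2 := sum_range_mul_pow_sq_le (c := c) hq0 hq1 k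
  have h3 : 0 ≤ ∑ k ∈ Finset.range k, 2 * (c * q ^ k) ^ 2 :=
    Finset.sum_nonneg fun _ _ => by positivity
  have hnf : 0 ≤ ((Fintype.card V : ℝ) - f) / 4 := by
    have : ((3 * f + 1 : ℕ) : ℝ) < Fintype.card V := by exact_mod_cast hrob.lt_card hn
    push_cast at this
    have hf : (0 : ℝ) ≤ f := by positivity
    linarith
  calc ∑ a ∈ Finset.range k ×ˢ Finset.univ, C a
      = ((1 / ((f : ℝ) + 2)) ^ 2 * ∑ j, multiplicity G F j) *
          ∑ k ∈ Finset.range k, 2 * (c * q ^ k) ^ 2 := by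
        rw [Finset.sum_product_right, mul_assoc, Finset.sum_mul, Finset.mul_sum]
        refine Finset.sum_congr rfl fun j _ => ?_
        rw [Finset.mul_sum, Finset.mul_sum]
    _ ≤ ((Fintype.card V : ℝ) - f) / 4 * (2 * c ^ 2 / (1 - q ^ 2)) :=
        mul_le_mul h1 h2 h3 hnf
    _ = c ^ 2 * ((Fintype.card V : ℝ) - f) / (2 * (1 - q ^ 2)) := by
        field_simp
        ring

end NoiseVariance

/-! ### Mean square limits and Chebyshev's inequality -/

section MeanSquare

/-- Summing the recursion bounds `(1 - γ)` times every partial sum of `d`, so `d` is even summable.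
-/
theorem tendsto_zero_of_le_mul_add {d e : ℕ → ℝ} (hd : ∀ k, 0 ≤ d k) (he : ∀ k, 0 ≤ e k)
    (hsum : Summable e) {γ : ℝ} (hγ : γ < 1) {n : ℕ} (h : ∀ k, d (k + n) ≤ γ * d k + e k) :
    Tendsto d atTop (𝓝 0) := by
  refine (summable_of_sum_range_le (c := (∑ k ∈ Finset.range n, d k + ∑' k, e k) / (1 - γ)) hd
    fun K => ?_).tendsto_atTop_zero
  have h1 : ∑ k ∈ Finset.range K, d k ≤ ∑ k ∈ Finset.range (n + K), d k :=
    Finset.sum_le_sum_of_subset_of_nonneg (Finset.range_mono (by omega)) fun k _ _ => hd k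
  have h2 : ∑ k ∈ Finset.range K, d (n + k) ≤
      γ * ∑ k ∈ Finset.range K, d k + ∑ k ∈ Finset.range K, e k := by
    rw [Finset.mul_sum, ← Finset.sum_add_distrib]
    exact Finset.sum_le_sum fun k _ => by rw [add_comm n k]; exact h k
  have h3 := hsum.sum_le_tsum (Finset.range K) fun k _ => he k
  rw [Finset.sum_range_add] at h1
  rw [le_div_iff₀ (by linarith)]
  linarith

variable {Ω : Type*} [MeasurableSpace Ω] {P : Measure Ω}

theorem lintegral_sq_eq_ofReal_lpNorm {φ : Ω → ℝ} (hφ : MemLp φ 2 P) :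
    ∫⁻ ω, ENNReal.ofReal (φ ω ^ 2) ∂P = ENNReal.ofReal (lpNorm φ 2 P ^ 2) := by
  rw [lintegral_sq_eq_ofReal hφ, lpNorm_eq_integral_norm_rpow_toReal (by norm_num) (by norm_num)
    hφ.aestronglyMeasurable]
  congr 1
  have h : ∀ ω, ‖φ ω‖ ^ (ENNReal.toReal 2) = φ ω ^ 2 := fun ω => by
    rw [ENNReal.toReal_ofNat, Real.rpow_ofNat, Real.norm_eq_abs, sq_abs]
  simp_rw [h]
  rw [← Real.rpow_natCast, ← Real.rpow_mul (integral_nonneg fun ω => sq_nonneg _)]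
  norm_num

theorem lpNorm_sq_eq_integral {φ : Ω → ℝ} (hφ : MemLp φ 2 P) :
    lpNorm φ 2 P ^ 2 = ∫ ω, φ ω ^ 2 ∂P := by
  have h1 := lintegral_sq_eq_ofReal_lpNorm hφ
  rw [lintegral_sq_eq_ofReal hφ] at h1
  exact ((ENNReal.ofReal_eq_ofReal_iff (integral_nonneg fun ω => sq_nonneg _)
    (sq_nonneg _)).mp h1).symm

theorem norm_toLp_sub_toLp {φ ψ : Ω → ℝ} (hφ : MemLp φ 2 P) (hψ : MemLp ψ 2 P) :
    ‖hφ.toLp φ - hψ.toLp ψ‖ = lpNorm (φ - ψ) 2 P := by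
  rw [← MemLp.toLp_sub, Lp.norm_toLp, toReal_eLpNorm (hφ.sub hψ).aestronglyMeasurable]

theorem exists_tendsto_lpNorm_sub {X : ℕ → Ω → ℝ} (hX : ∀ k, MemLp (X k) 2 P) {b : ℕ → ℝ}
    (hb : Tendsto b atTop (𝓝 0)) (h : ∀ k l, lpNorm (X (k + l) - X k) 2 P ≤ b k) :
    ∃ Y : Ω → ℝ, Measurable Y ∧ MemLp Y 2 P ∧
      Tendsto (fun k => lpNorm (X k - Y) 2 P) atTop (𝓝 0) := by
  have hc : CauchySeq fun k => (hX k).toLp (X k) := by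
    refine cauchySeq_of_le_tendsto_0' b (fun k m hkm => ?_) hb
    obtain ⟨l, rfl⟩ := Nat.exists_eq_add_of_le hkm
    rw [dist_comm, dist_eq_norm, norm_toLp_sub_toLp]
    exact h k l
  obtain ⟨Y, hY⟩ := cauchySeq_tendsto_of_complete hc
  refine ⟨Y, (Lp.stronglyMeasurable Y).measurable, Lp.memLp Y, ?_⟩
  have h2 := tendsto_iff_norm_sub_tendsto_zero.mp hY
  refine h2.congr fun k => ?_
  conv_lhs => rw [← Lp.toLp_coeFn Y (Lp.memLp Y)]
  rw [norm_toLp_sub_toLp]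

theorem tendstoInMeanSquare_of_lpNorm {X : ℕ → Ω → ℝ} {Y : Ω → ℝ} (hX : ∀ k, MemLp (X k) 2 P)
    (hY : MemLp Y 2 P) (h : Tendsto (fun k => lpNorm (X k - Y) 2 P) atTop (𝓝 0)) :
    TendstoInMeanSquare P X Y := by
  refine ⟨hX, ?_⟩
  have h1 : Tendsto (fun k => ENNReal.ofReal (lpNorm (X k - Y) 2 P ^ 2)) atTop (𝓝 0) := by
    simpa using ENNReal.tendsto_ofReal (h.pow 2)
  refine h1.congr fun k => ?_
  rw [← lintegral_sq_eq_ofReal_lpNorm ((hX k).sub hY)]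
  simp [sq_abs]

variable [IsProbabilityMeasure P]

/-- The standard deviation is the `L²` distance to the constants, hence changes by at most the `L²`
distance of the variables. The centre `m` may vary with `k`. -/
theorem variance_le_of_tendsto {X : ℕ → Ω → ℝ} {Y : Ω → ℝ} {v : ℝ} (hv : 0 ≤ v)
    (hX : ∀ k, MemLp (X k) 2 P) (hY : MemLp Y 2 P)
    (h : Tendsto (fun k => lpNorm (X k - Y) 2 P) atTop (𝓝 0))
    (hvar : ∀ k, ∃ m : ℝ, ∫⁻ ω, ENNReal.ofReal ((X k ω - m) ^ 2) ∂P ≤ ENNReal.ofReal v) :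
    Var[Y; P] ≤ v := by
  have hYc : ∀ t : ℝ, MemLp (fun ω => Y ω - t) 2 P := fun t => hY.sub (memLp_const t)
  have hXc : ∀ k (t : ℝ), MemLp (fun ω => X k ω - t) 2 P := fun k t => (hX k).sub (memLp_const t)
  have hle : ∀ k, √(Var[Y; P]) ≤ lpNorm (X k - Y) 2 P + √v := by
    intro k
    obtain ⟨m, hm⟩ := hvar k
    rw [lintegral_sq_eq_ofReal_lpNorm (hXc k m), ENNReal.ofReal_le_ofReal_iff hv] at hm
    have h1 : lpNorm (fun ω => X k ω - m) 2 P ≤ √v := Real.le_sqrt_of_sq_le hm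
    have h2 : lpNorm (fun ω => Y ω - m) 2 P ≤
        lpNorm (Y - X k) 2 P + lpNorm (fun ω => X k ω - m) 2 P := by
      have := lpNorm_add_le (hY.sub (hX k)) (g := fun ω => X k ω - m) (p := 2) (by norm_num)
      convert this using 2
      ext ω
      simp
    have h3 : Var[Y; P] ≤ lpNorm (fun ω => Y ω - m) 2 P ^ 2 := by
      rw [lpNorm_sq_eq_integral (hYc m), variance_eq_integral hY.aemeasurable,
        integral_sub_sq hY, integral_sub_sq hY]
      nlinarith [sq_nonneg (∫ ω, Y ω ∂P - m)]
    rw [lpNorm_sub_comm] at h2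
    exact (Real.sqrt_le_iff.mpr ⟨lpNorm_nonneg, h3⟩).trans (h2.trans (by linarith))
  have hlim : √(Var[Y; P]) ≤ 0 + √v := ge_of_tendsto' (h.add_const _) hle
  rwa [zero_add, Real.sqrt_le_sqrt_iff hv] at hlim

theorem le_prob_abs_sub_le {Y : Ω → ℝ} (hm : Measurable Y) (hY : MemLp Y 2 P) {p r : ℝ}
    (hr : 0 < r) (hvar : Var[Y; P] ≤ p * r ^ 2) :
    1 - p ≤ P.real {ω | |Y ω - ∫ ω', Y ω' ∂P| ≤ r} := by
  have h1 := meas_ge_le_variance_div_sq hY hr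
  have hset : MeasurableSet {ω | |Y ω - ∫ ω', Y ω' ∂P| ≤ r} :=
    measurableSet_le (by fun_prop) measurable_const
  have h2 : P.real {ω | |Y ω - ∫ ω', Y ω' ∂P| ≤ r}ᶜ ≤ Var[Y; P] / r ^ 2 := by
    refine ENNReal.toReal_le_of_le_ofReal (div_nonneg (variance_nonneg _ _) (sq_nonneg _))
      ((measure_mono fun ω hω => ?_).trans h1)
    simp only [Set.mem_compl_iff, Set.mem_ofPred_eq, not_le] at hω ⊢
    exact hω.le
  rw [probReal_compl_eq_one_sub hset] at h2
  have h3 : Var[Y; P] / r ^ 2 ≤ p := by rwa [div_le_iff₀ (by positivity)]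
  linarith

end MeanSquare

/-! ### Convergence of the non-faulty states in `L²` -/

section Consensus

open scoped Classical

variable {V : Type*} [Fintype V] {G : Digraph V} {F : Finset V} {f : ℕ}
  {Ω : Type*} {η : ℕ → V → Ω → ℝ} {ηhat : ℕ → V → V → Ω → ℝ}
  {θhat : ℕ → V → V → ℝ} {θ₀ : V → ℝ} {θ : ℕ → V → Ω → ℝ}

/-- The total absolute value of the noises of the agents outside `F`. -/
def totalNoise (F : Finset V) (η : ℕ → V → Ω → ℝ) (k : ℕ) (ω : Ω) : ℝ :=
  ∑ j ∈ Fᶜ, |η k j ω|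

/-- The largest difference between the states of agents outside `F`. -/
def spread (F : Finset V) (hne : Fᶜ.Nonempty) (θ : ℕ → V → Ω → ℝ) (k : ℕ) (ω : Ω) : ℝ :=
  Fᶜ.sup' hne (fun i => θ k i ω) - Fᶜ.inf' hne (fun i => θ k i ω)

theorem IsExecution.isTrimmedPath (h : IsExecution G F f θhat η ηhat θ₀ θ) (ω : Ω) :
    IsTrimmedPath G F f (fun k i => θ k i ω)
      (fun k i j => message F θhat η ηhat θ k j i ω) (fun k => totalNoise F η k ω) where
  step k i hi := h.step k i hi ω
  msg k i j hj := by
    simp only [message, noise, hj, if_false, add_sub_cancel_left]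
    exact Finset.single_le_sum (f := fun j => |η k j ω|) (fun _ _ => abs_nonneg _)
      (Finset.mem_compl.mpr hj)

/-- No attack signal enters the bound, since trimming confines retained messages to the non-faulty
range; finite second moments follow by induction. -/
theorem IsExecution.abs_succ_le (h : IsExecution G F f θhat η ηhat θ₀ θ) (hF : F.card ≤ f)
    (k : ℕ) {i : V} (hi : i ∉ F) (ω : Ω) :
    |θ (k + 1) i ω| ≤ ∑ j ∈ Fᶜ, |θ k j ω| + totalNoise F η k ω := by
  have hle : ∀ j ∉ F, |θ k j ω| ≤ ∑ j ∈ Fᶜ, |θ k j ω| := fun j hj =>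
    Finset.single_le_sum (f := fun j => |θ k j ω|) (fun _ _ => abs_nonneg _)
      (Finset.mem_compl.mpr hj)
  have h1 := (h.isTrimmedPath ω).step_le hF
    (fun j hj => (le_abs_self _).trans (hle j hj)) hi
  have h2 := (h.isTrimmedPath ω).neg.step_le hF
    (fun j hj => (neg_le_abs _).trans (hle j hj)) hi
  exact abs_le.mpr ⟨by linarith, h1⟩

theorem abs_sub_le_spread (hne : Fᶜ.Nonempty) (k : ℕ) (ω : Ω) {i j : V} (hi : i ∉ F)
    (hj : j ∉ F) : |θ k i ω - θ k j ω| ≤ spread F hne θ k ω := by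
  have hle : ∀ l ∉ F, θ k l ω ≤ Fᶜ.sup' hne (fun i => θ k i ω) := fun l hl =>
    Finset.le_sup' (fun i => θ k i ω) (Finset.mem_compl.mpr hl)
  have hge : ∀ l ∉ F, Fᶜ.inf' hne (fun i => θ k i ω) ≤ θ k l ω := fun l hl =>
    Finset.inf'_le (fun i => θ k i ω) (Finset.mem_compl.mpr hl)
  rw [spread, abs_le]
  constructor <;> linarith [hle i hi, hle j hj, hge i hi, hge j hj]

theorem spread_nonneg (hne : Fᶜ.Nonempty) (k : ℕ) (ω : Ω) : 0 ≤ spread F hne θ k ω := by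
  obtain ⟨i, hi⟩ := hne
  have hi' := Finset.mem_compl.mp hi
  exact (abs_nonneg _).trans (abs_sub_le_spread ⟨i, hi⟩ k ω hi' hi')

theorem IsExecution.spread_add_le (h : IsExecution G F f θhat η ηhat θ₀ θ) (hF : F.card ≤ f)
    (hrob : IsRobust G (3 * f + 1)) (hne : Fᶜ.Nonempty) (k : ℕ) (ω : Ω) :
    spread F hne θ (k + Fintype.card V) ω ≤
      (1 - (1 / ((Fintype.card V : ℝ) + 1)) ^ Fintype.card V / 2) * spread F hne θ k ω +
        2 * ∑ s ∈ Finset.range (Fintype.card V), totalNoise F η (k + s) ω := by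
  obtain ⟨i, hi, hsup⟩ := Finset.exists_mem_eq_sup' hne fun i => θ (k + Fintype.card V) i ω
  obtain ⟨j, hj, hinf⟩ := Finset.exists_mem_eq_inf' hne fun i => θ (k + Fintype.card V) i ω
  have h0 := spread_nonneg (θ := θ) hne k ω
  rw [spread] at h0
  rw [spread, hsup, hinf]
  exact (h.isTrimmedPath ω).sub_le_contraction hF hrob (sub_nonneg.mp h0)
    (fun l hl => Finset.inf'_le (fun i => θ k i ω) (Finset.mem_compl.mpr hl))
    (fun l hl => Finset.le_sup' (fun i => θ k i ω) (Finset.mem_compl.mpr hl))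
    (Finset.mem_compl.mp hi) (Finset.mem_compl.mp hj)

theorem IsExecution.abs_add_sub_le (h : IsExecution G F f θhat η ηhat θ₀ θ) (hF : F.card ≤ f)
    (hne : Fᶜ.Nonempty) (k l : ℕ) (ω : Ω) {i : V} (hi : i ∉ F) :
    |θ (k + l) i ω - θ k i ω| ≤
      spread F hne θ k ω + ∑ s ∈ Finset.range l, totalNoise F η (k + s) ω :=
  (h.isTrimmedPath ω).abs_sub_le hF
    (fun _ hj => Finset.inf'_le (fun i => θ k i ω) (Finset.mem_compl.mpr hj))
    (fun _ hj => Finset.le_sup' (fun i => θ k i ω) (Finset.mem_compl.mpr hj)) l hi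

variable [MeasurableSpace Ω] {P : Measure Ω}

theorem memLp_totalNoise (hη : ∀ k, ∀ i ∉ F, MemLp (η k i) 2 P) (k : ℕ) :
    MemLp (totalNoise F η k) 2 P :=
  memLp_finsetSum _ fun j hj => (hη k j (Finset.mem_compl.mp hj)).abs

theorem lpNorm_totalNoise_le {b : ℝ} {k : ℕ} (hη : ∀ i ∉ F, MemLp (η k i) 2 P)
    (hb : ∀ i ∉ F, lpNorm (η k i) 2 P ≤ b) :
    lpNorm (totalNoise F η k) 2 P ≤ Fᶜ.card * b := by
  have h1 := lpNorm_sum_le (s := Fᶜ) (f := fun j ω => |η k j ω|) (p := 2) (μ := P)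
    (fun j hj => (hη j (Finset.mem_compl.mp hj)).abs) (by norm_num)
  have h2 : totalNoise F η k = ∑ j ∈ Fᶜ, fun ω => |η k j ω| := by
    ext ω
    simp [totalNoise]
  rw [h2, ← nsmul_eq_mul]
  refine h1.trans (Finset.sum_le_card_nsmul _ _ _ fun j hj => ?_)
  rw [lpNorm_fun_abs (hη j (Finset.mem_compl.mp hj)).aestronglyMeasurable]
  exact hb j (Finset.mem_compl.mp hj)

theorem memLp_spread (hne : Fᶜ.Nonempty) (hmeas : ∀ k, ∀ i ∉ F, Measurable (θ k i)) {k : ℕ}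
    (hθ : ∀ i ∉ F, MemLp (θ k i) 2 P) : MemLp (spread F hne θ k) 2 P := by
  have hm : ∀ i ∈ Fᶜ, Measurable (θ k i) := fun i hi => hmeas k i (Finset.mem_compl.mp hi)
  have h1 : Measurable (spread F hne θ k) := by
    have hs := (Finset.measurable_sup' hne hm).sub (Finset.inf'_induction hne (θ k)
      (fun _ h1 _ h2 => h1.inf h2) hm)
    convert hs using 1
    ext ω
    simp [spread, Finset.sup'_apply, Finset.inf'_apply]
  have h2 : MemLp (fun ω => ∑ i ∈ Fᶜ, |θ k i ω| + ∑ i ∈ Fᶜ, |θ k i ω|) 2 P := by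
    have := memLp_finsetSum (f := fun i ω => |θ k i ω|) Fᶜ
      fun i hi => (hθ i (Finset.mem_compl.mp hi)).abs
    exact this.add this
  refine h2.mono h1.aestronglyMeasurable (ae_of_all _ fun ω => ?_)
  rw [Real.norm_of_nonneg (spread_nonneg hne k ω)]
  refine le_trans ?_ (le_abs_self _)
  have hle : ∀ j ∈ Fᶜ, |θ k j ω| ≤ ∑ j ∈ Fᶜ, |θ k j ω| := fun j hj =>
    Finset.single_le_sum (f := fun j => |θ k j ω|) (fun _ _ => abs_nonneg _) hj
  have h3 : Fᶜ.sup' hne (fun i => θ k i ω) ≤ ∑ j ∈ Fᶜ, |θ k j ω| :=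
    Finset.sup'_le hne _ fun j hj => (le_abs_self _).trans (hle j hj)
  have h4 : -∑ j ∈ Fᶜ, |θ k j ω| ≤ Fᶜ.inf' hne (fun i => θ k i ω) :=
    Finset.le_inf' hne _ fun j hj => by linarith [hle j hj, neg_abs_le (θ k j ω)]
  rw [spread]
  linarith

theorem lpNorm_sum_totalNoise_le {C q : ℝ} (hq0 : 0 ≤ q) (hq1 : q < 1) (hC : 0 ≤ C)
    (hη : ∀ k, ∀ i ∉ F, MemLp (η k i) 2 P)
    (hW : ∀ k, lpNorm (totalNoise F η k) 2 P ≤ C * q ^ k) (k l : ℕ) :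
    lpNorm (fun ω => ∑ s ∈ Finset.range l, totalNoise F η (k + s) ω) 2 P ≤
      C / (1 - q) * q ^ k := by
  have h1 := lpNorm_sum_le (s := Finset.range l) (f := fun s => totalNoise F η (k + s)) (p := 2)
    (μ := P) (fun s _ => memLp_totalNoise hη _) (by norm_num)
  have h2 : (fun ω => ∑ s ∈ Finset.range l, totalNoise F η (k + s) ω) =
      ∑ s ∈ Finset.range l, totalNoise F η (k + s) := by
    ext ω
    simp
  rw [h2]
  have h3 := (summable_geometric_of_lt_one hq0 hq1).sum_le_tsum (Finset.range l)
    fun _ _ => by positivity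
  rw [tsum_geometric_of_lt_one hq0 hq1] at h3
  calc _ ≤ ∑ s ∈ Finset.range l, C * q ^ (k + s) := h1.trans (Finset.sum_le_sum fun s _ => hW _)
    _ = C * q ^ k * ∑ s ∈ Finset.range l, q ^ s := by
      rw [Finset.mul_sum]
      exact Finset.sum_congr rfl fun s _ => by rw [pow_add]; ring
    _ ≤ C * q ^ k * (1 - q)⁻¹ := by gcongr
    _ = _ := by rw [div_eq_mul_inv]; ring

variable [IsProbabilityMeasure P]

theorem IsExecution.memLp (h : IsExecution G F f θhat η ηhat θ₀ θ) (hF : F.card ≤ f)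
    (hmeas : ∀ k, ∀ i ∉ F, Measurable (θ k i)) (hη : ∀ k, ∀ i ∉ F, MemLp (η k i) 2 P) (k : ℕ) :
    ∀ i ∉ F, MemLp (θ k i) 2 P := by
  induction k with
  | zero =>
    intro i hi
    have : θ 0 i = fun _ => θ₀ i := funext fun ω => h.init i hi ω
    rw [this]
    exact memLp_const _
  | succ k ih =>
    intro i hi
    have h1 : MemLp (fun ω => ∑ j ∈ Fᶜ, |θ k j ω| + totalNoise F η k ω) 2 P :=
      (memLp_finsetSum _ fun j hj => (ih j (Finset.mem_compl.mp hj)).abs).add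
        (memLp_totalNoise hη k)
    refine h1.mono (hmeas _ i hi).aestronglyMeasurable (ae_of_all _ fun ω => ?_)
    exact (h.abs_succ_le hF k hi ω).trans (le_abs_self _)

/-- The `L²` norm turns the pathwise contraction over `n` steps into a scalar recursion with
summable error. -/
theorem IsExecution.tendsto_lpNorm_spread (h : IsExecution G F f θhat η ηhat θ₀ θ)
    (hF : F.card ≤ f) (hrob : IsRobust G (3 * f + 1)) (hne : Fᶜ.Nonempty)
    {C q : ℝ} (hq0 : 0 ≤ q) (hq1 : q < 1) (hC : 0 ≤ C)
    (hmeas : ∀ k, ∀ i ∉ F, Measurable (θ k i)) (hη : ∀ k, ∀ i ∉ F, MemLp (η k i) 2 P)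
    (hW : ∀ k, lpNorm (totalNoise F η k) 2 P ≤ C * q ^ k) :
    Tendsto (fun k => lpNorm (spread F hne θ k) 2 P) atTop (𝓝 0) := by
  set n := Fintype.card V
  set α : ℝ := (1 / ((n : ℝ) + 1)) ^ n / 2 with hα
  have hα0 : 0 < α := by positivity
  have hα1 : α ≤ 1 := by
    have : (1 / ((n : ℝ) + 1)) ^ n ≤ 1 := pow_le_one₀ (by positivity) (by
      rw [div_le_one (by positivity)]
      linarith [show (0 : ℝ) ≤ n by positivity])
    linarith
  have hq1' : 0 < 1 - q := by linarith
  refine tendsto_zero_of_le_mul_add (γ := 1 - α) (n := n)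
    (e := fun k => 2 * (C / (1 - q) * q ^ k)) (fun _ => lpNorm_nonneg) (fun k => by positivity)
    (((summable_geometric_of_lt_one hq0 hq1).mul_left _).mul_left _) (by linarith) fun k => ?_
  have hsp : ∀ k, MemLp (spread F hne θ k) 2 P := fun k =>
    memLp_spread hne hmeas (h.memLp hF hmeas hη k)
  have hsumL : MemLp (fun ω => ∑ s ∈ Finset.range n, totalNoise F η (k + s) ω) 2 P :=
    memLp_finsetSum _ fun s _ => memLp_totalNoise hη _
  have h1 : lpNorm (spread F hne θ (k + n)) 2 P ≤ lpNorm ((1 - α) • spread F hne θ k +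
      (2 : ℝ) • fun ω => ∑ s ∈ Finset.range n, totalNoise F η (k + s) ω) 2 P := by
    refine lpNorm_mono_real (((hsp k).const_smul _).add (hsumL.const_smul _)) fun ω => ?_
    rw [Real.norm_of_nonneg (spread_nonneg hne _ ω)]
    exact h.spread_add_le hF hrob hne k ω
  have h2 := lpNorm_add_le ((hsp k).const_smul (1 - α))
    (g := (2 : ℝ) • fun ω => ∑ s ∈ Finset.range n, totalNoise F η (k + s) ω) (p := 2)
    (by norm_num)
  rw [lpNorm_const_smul, lpNorm_const_smul] at h2
  simp only [coe_nnnorm, Real.norm_of_nonneg (sub_nonneg.mpr hα1), Real.norm_ofNat] at h2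
  have h3 := lpNorm_sum_totalNoise_le hq0 hq1 hC hη hW k n
  linarith

/-- A state moves after time `k` by at most the spread at `k` plus the subsequent noise, so one
agent's states are Cauchy in `L²`. The vanishing spread gives the other agents the same limit. -/
theorem IsExecution.exists_tendsto (h : IsExecution G F f θhat η ηhat θ₀ θ)
    (hF : F.card ≤ f) (hrob : IsRobust G (3 * f + 1)) (hne : Fᶜ.Nonempty)
    {C q : ℝ} (hq0 : 0 ≤ q) (hq1 : q < 1) (hC : 0 ≤ C)
    (hmeas : ∀ k, ∀ i ∉ F, Measurable (θ k i)) (hη : ∀ k, ∀ i ∉ F, MemLp (η k i) 2 P)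
    (hW : ∀ k, lpNorm (totalNoise F η k) 2 P ≤ C * q ^ k) :
    ∃ Y : Ω → ℝ, Measurable Y ∧ MemLp Y 2 P ∧
      ∀ i ∉ F, Tendsto (fun k => lpNorm (θ k i - Y) 2 P) atTop (𝓝 0) := by
  have hspread := h.tendsto_lpNorm_spread hF hrob hne hq0 hq1 hC hmeas hη hW
  have hθ := h.memLp hF hmeas hη
  have hsp : ∀ k, MemLp (spread F hne θ k) 2 P := fun k => memLp_spread hne hmeas (hθ k)
  obtain ⟨i₀, hi₀⟩ := id hne
  have hi₀F := Finset.mem_compl.mp hi₀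
  obtain ⟨Y, hYm, hY, hlim⟩ := exists_tendsto_lpNorm_sub (fun k => hθ k i₀ hi₀F)
    (b := fun k => lpNorm (spread F hne θ k) 2 P + C / (1 - q) * q ^ k)
    (by
      have := (tendsto_pow_atTop_nhds_zero_of_lt_one hq0 hq1).const_mul (C / (1 - q))
      simpa using hspread.add this)
    (fun k l => by
      have hsumL : MemLp (fun ω => ∑ s ∈ Finset.range l, totalNoise F η (k + s) ω) 2 P :=
        memLp_finsetSum _ fun s _ => memLp_totalNoise hη _
      have h1 := lpNorm_mono_real ((hsp k).add hsumL) (f := θ (k + l) i₀ - θ k i₀)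
        fun ω => h.abs_add_sub_le hF hne k l ω hi₀F
      have h2 := lpNorm_add_le (hsp k)
        (g := fun ω => ∑ s ∈ Finset.range l, totalNoise F η (k + s) ω) (p := 2) (by norm_num)
      have h3 := lpNorm_sum_totalNoise_le hq0 hq1 hC hη hW k l
      linarith)
  refine ⟨Y, hYm, hY, fun i hi => ?_⟩
  refine squeeze_zero (fun _ => lpNorm_nonneg) (fun k => ?_)
    (by simpa using hspread.add hlim)
  have h1 := lpNorm_mono_real (hsp k) (f := θ k i - θ k i₀)
    fun ω => abs_sub_le_spread hne k ω hi hi₀F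
  have h2 := lpNorm_sub_le_lpNorm_sub_add_lpNorm_sub (h := Y) (hθ k i hi) (hθ k i₀ hi₀F)
    (p := 2) (by norm_num)
  linarith

end Consensus

end DPMSR

end

/-! ### The accuracy bound -/

theorem proposition3 {V : Type*} [Fintype V] (G : Digraph V)
    (hloop : ∀ i, ¬ G.Adj i i) (hn : 2 ≤ Fintype.card V)
    (f : ℕ) (hrob : DPMSR.IsRobust G (3 * f + 1))
    (F : Finset V) (hF : F.card ≤ f)
    (c q : ℝ) (hc : 0 < c) (hq : 1 / 2 < q) (hq' : q < 1)
    {Ω : Type*} [MeasurableSpace Ω] (P : Measure Ω) [IsProbabilityMeasure P]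
    (η : ℕ → V → Ω → ℝ) (ηhat : ℕ → V → V → Ω → ℝ)
    (hη_meas : ∀ k, ∀ i ∉ F, Measurable (η k i))
    (hη_law : ∀ k, ∀ i ∉ F, P.map (η k i) = DPMSR.laplace (c * q ^ k))
    (hηhat_meas : ∀ k, ∀ i ∈ F, ∀ j, Measurable (ηhat k i j))
    (hηhat_memLp : ∀ k, ∀ i ∈ F, ∀ j, G.Adj i j → MemLp (ηhat k i j) 2 P)
    (hηhat_mean : ∀ k, ∀ i ∈ F, ∀ j, G.Adj i j → ∫ ω, ηhat k i j ω ∂P = 0)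
    (hηhat_var : ∀ k, ∀ i ∈ F, ∀ j, G.Adj i j → Var[ηhat k i j; P] ≤ 2 * (c * q ^ k) ^ 2)
    (hindep : iIndepFun (fun (a : ℕ × V) (ω : Ω) => DPMSR.noise F η ηhat a.1 a.2 ω) P)
    (p : ℝ) (hp : 0 < p) (hp' : p < 1) :
    DPMSR.IsAccurate P F (DPMSR.dynamics G F f η ηhat) p
      (c * √(((Fintype.card V : ℝ) - f) / (2 * p * (1 - q ^ 2)))) := by
  classical
  rintro θ₀ θ ⟨θhat, h⟩
  have hq0 : 0 < q := by linarith
  have hq2 : 0 < 1 - q ^ 2 := by nlinarith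
  have hcard := hrob.lt_card hn
  have hnf : 0 < (Fintype.card V : ℝ) - f := by
    have : (f : ℝ) < Fintype.card V := by exact_mod_cast (by omega : f < Fintype.card V)
    linarith
  have hne : Fᶜ.Nonempty := by
    rw [← Finset.card_pos, Finset.card_compl]
    omega
  have hsq : ∀ k, ∀ i ∉ F, ∫⁻ ω, ENNReal.ofReal (η k i ω ^ 2) ∂P =
      ENNReal.ofReal (2 * (c * q ^ k) ^ 2) := fun k i hi =>
    DPMSR.lintegral_sq_of_map_laplace (hη_meas k i hi) (by positivity) (hη_law k i hi)
  have hη : ∀ k, ∀ i ∉ F, MemLp (η k i) 2 P := fun k i hi =>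
    DPMSR.memLp_two_of_lintegral_sq_lt_top (hη_meas k i hi)
      (by rw [hsq k i hi]; exact ENNReal.ofReal_lt_top)
  -- The exact norm is `√2 * (c * q ^ k)`; only geometric decay matters for convergence.
  have hη_norm : ∀ k, ∀ i ∉ F, lpNorm (η k i) 2 P ≤ 2 * (c * q ^ k) := by
    intro k i hi
    have h1 := hsq k i hi
    rw [DPMSR.lintegral_sq_eq_ofReal_lpNorm (hη k i hi),
      ENNReal.ofReal_eq_ofReal_iff (sq_nonneg _) (by positivity)] at h1
    refine (sq_le_sq₀ lpNorm_nonneg (by positivity)).mp ?_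
    rw [h1]
    nlinarith [sq_nonneg (c * q ^ k)]
  have hW : ∀ k, lpNorm (DPMSR.totalNoise F η k) 2 P ≤ Fᶜ.card * (2 * c) * q ^ k := fun k =>
    (DPMSR.lpNorm_totalNoise_le (hη k) (hη_norm k)).trans_eq (by ring)
  have hnoise := DPMSR.measurable_noise hη_meas hηhat_meas
  have hmeas : ∀ k, ∀ i ∉ F, Measurable (θ k i) := by
    intro k i hi
    rw [show θ k i = _ from funext fun ω => h.eq_flow ω k i hi]
    exact ((measurable_pi_apply i).comp
      (DPMSR.measurable_flow (hrob.two_mul_le_card hn) k)).comp (measurable_pi_iff.mpr hnoise)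
  obtain ⟨Y, hYm, hY, hlim⟩ := h.exists_tendsto hF hrob hne hq0.le hq' (by positivity)
    hmeas hη hW
  have hθ := h.memLp hF hmeas hη
  refine ⟨Y, hYm, hY.integrable one_le_two, fun i hi =>
    DPMSR.tendstoInMeanSquare_of_lpNorm (fun k => hθ k i hi) hY (hlim i hi), ?_⟩
  obtain ⟨i, hi⟩ := hne
  have hi' := Finset.mem_compl.mp hi
  have hvar := DPMSR.variance_le_of_tendsto (by positivity) (fun k => hθ k i hi') hY (hlim i hi')
    (h.exists_lintegral_sub_sq_le hloop hn hrob hF hc hq0 hq' hη_meas hη_law hηhat_meas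
      hηhat_memLp hηhat_mean hηhat_var hindep hi')
  -- The radius `r` is chosen so that `p * r ^ 2` equals the variance bound.
  refine DPMSR.le_prob_abs_sub_le hYm hY (by positivity) (hvar.trans_eq ?_)
  rw [mul_pow, Real.sq_sqrt (by positivity)]
  field_simp
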